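/- Let $\mathbb{H}=\{\tau\in\mathbb{C} : \operatorname{Im}\tau>0\}$, and let $E_6(\tau)=1-504\sum_{n\ge 1}\sigma_5(n)e^{2\pi i n\tau}$ be the normalized Eisenstein series of weight $6$ on $\mathbb{H}$, where $\sigma_5(n)=\sum_{k\mid n}k^5$; write $E_6'$ for its derivative with respect to $\tau$. Let $$\Gamma_0(2)=\left\{\begin{pmatrix}a&b\\c&d\end{pmatrix}\in SL(2,\mathbb{Z}) : c\equiv 0 \bmod 2\right\},\qquad F_0=\{\tau\in\mathbb{H} : 0\le \operatorname{Re}\tau\le 1,\ |\tau-\tfrac12|\ge\tfrac12\},$$ and for $\gamma=\begin{pmatrix}a&b\\c&d\end{pmatrix}\in\Gamma_0(2)$ put $\gamma(F_0)=\{\frac{a\tau+b}{c\tau+d} : \tau\in F_0\}$. Then there is a point $\tau_\infty=\frac12+i\,b_\infty$ with $b_\infty\in(\frac12,\frac{\sqrt3}{2})$ such that for every $\gamma=\begin{pmatrix}a&b\\c&d\end{pmatrix}\in\Gamma_0(2)$ the following hold. (1) If $c=0$, then $m:=b/d$ is an integer, $\gamma(F_0)=F_0+m$, and $E_6'$ has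 exactly one zero in $\gamma(F_0)$, namely $\tau_\infty+m$. (2) If $c\neq 0$, then $E_6'$ has exactly two distinct zeros in $\gamma(F_0)$, and both lie in the interior of $\gamma(F_0)$. -/

import Mathlib

open scoped UpperHalfPlane MatrixGroups

noncomputable section

/-- The basic fundamental domain `F₀` of `Γ₀(2)`:
all `τ ∈ ℍ` with `0 ≤ Re τ ≤ 1` and `|τ - 1/2| ≥ 1/2`. -/
def basicDomain : Set ℍ :=
  {τ : ℍ | 0 ≤ τ.re ∧ τ.re ≤ 1 ∧ 1 / 2 ≤ ‖(τ : ℂ) - 1 / 2‖}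

/-- The translate `γ(F₀)` of the basic fundamental domain under the Möbius action of `γ`. -/
def translatedDomain (γ : SL(2, ℤ)) : Set ℍ :=
  (fun τ : ℍ => γ • τ) '' basicDomain

/-- The complex derivative `E₆'(τ)` of the normalized Eisenstein series `E₆` of weight 6.
`ofComplex` extends functions on `ℍ` to functions on `ℂ`, and is the identity on the open
upper half plane. -/
def derivE6 (τ : ℍ) : ℂ :=
  deriv (fun z : ℂ => ModularForm.E₆ (UpperHalfPlane.ofComplex z)) (τ : ℂ)

/-- The critical points of `E₆` that lie in a set `S ⊆ ℍ`. -/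
def criticalPointsIn (S : Set ℍ) : Set ℍ :=
  {τ : ℍ | τ ∈ S ∧ derivE6 τ = 0}

end

/-!
Let `h(τ) = τ + 6 E₆(τ) / E₆'(τ)`. Differentiating `E₆(γτ) = (cτ + d)⁶ E₆(τ)` shows that
`E₆'(γτ) = 0` if and only if `(cτ + d) E₆'(τ) + 6c E₆(τ) = 0`, that is, `h(τ) = -d/c` (where
`E₆'(τ) ≠ 0`). So the critical points in `γ(F₀)` correspond to the solutions of `h(τ) = -d/c` in
`F₀`.

`F₀` is the hyperbolic triangle with vertices `0, 1, ∞`. Its symmetry `τ ↦ 1 / (1 - τ)` belongs to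
`SL(2, ℤ)` and permutes the intervals `(1, ∞)`, `(-∞, 0)`, `(0, 1)` of values of `-d/c`; together
with the reflection `τ ↦ 1 - τ̄` it moves everything into the triangle
`T : 0 ≤ Re τ ≤ 1/2, |τ| ≥ 1`. What has to be shown is that on `T` the function `h` takes each real
value `r > 1` exactly once, in the interior (`exists_hFun_eq`), the value `1` exactly once, on
the unit circle (`exists_hFun_eq_one`), and no real value `r < 1` (`one_le_hFun_re`). The two
critical points in `γ(F₀)` are then the solutions in `T` and in one of the other five copies of `T`;
and `τ_∞` is the image under `τ ↦ 1 / (1 - τ)` of the point of `T` where `h = 1`.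

On `T` one has `|q| ≤ 1/230`, so that `q`-expansions can be estimated directly. With
`G = ∑ n σ₅(n) qⁿ` and `H = ∑ n² σ₅(n) qⁿ`,
`h = τ + i E₆ / (168 π G)` and `h' = 7 + E₆ H / (84 G²)`, and `Im h' < 0` for `0 < Re τ < 1/2`,
`Im τ ≥ √3/2` (`im_deriv_hFun_neg`). As this half-strip is convex, `h` is injective on it
(`injOn_hFun`). For existence, `h(T)` is closed and the image of the interior of `T` is open, while
on the boundary of `T` the function `h` is not real, or of modulus one: `Im h > 0` on `Re τ = 0`,
`Im h < 0` on `Re τ = 1/2`, and `|h| = 1` on the unit circle because `E₆'(-1/τ) = τ⁷ E₆'(τ) h(τ)`.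
Hence each of the connected sets `[0, 1)` and `(1, ∞)` is contained in `h(T)` or disjoint from it,
and one point of each decides: `0` is not a value as `Re h > 0`, and the intermediate value theorem
on `Im τ = 1` provides a value in `(1, ∞)`.
-/

open Complex

/-! ### Bounds for imaginary parts and the series `∑ nᵏ σ₅(n) qⁿ` -/

/-- `ImBound s F α β`: `F` has modulus at most `α`, and imaginary part at most `β s` in modulus.
With `s = Im q` this expresses, for a function `F` of `q` with real Taylor coefficients, that `F`
is bounded by `α` and that `Im F` vanishes to first order on the real axis. -/
def ImBound (s : ℝ) (F : ℂ) (α β : ℝ) : Prop := ‖F‖ ≤ α ∧ |F.im| ≤ β * s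

namespace ImBound

variable {s : ℝ} {F G : ℂ} {α β α' β' : ℝ}

lemma ofReal (r : ℝ) (s : ℝ) : ImBound s (r : ℂ) |r| 0 := by
  constructor <;> simp

lemma add (hF : ImBound s F α β) (hG : ImBound s G α' β') :
    ImBound s (F + G) (α + α') (β + β') := by
  refine ⟨(norm_add_le _ _).trans (add_le_add hF.1 hG.1), ?_⟩
  rw [add_im, add_mul]
  exact (abs_add_le _ _).trans (add_le_add hF.2 hG.2)

lemma mul (hF : ImBound s F α β) (hG : ImBound s G α' β') :
    ImBound s (F * G) (α * α') (α * β' + β * α') := by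
  have hα : 0 ≤ α := (norm_nonneg _).trans hF.1
  have hβ : 0 ≤ β * s := (abs_nonneg _).trans hF.2
  refine ⟨by rw [norm_mul]; exact mul_le_mul hF.1 hG.1 (norm_nonneg _) hα, ?_⟩
  calc |(F * G).im| ≤ |F.re| * |G.im| + |F.im| * |G.re| := by
        rw [mul_im, ← abs_mul, ← abs_mul]; exact abs_add_le _ _
    _ ≤ α * (β' * s) + β * s * α' := by
        gcongr
        · exact (abs_re_le_norm _).trans hF.1
        · exact hG.2
        · exact hF.2
        · exact (abs_re_le_norm _).trans hG.1
    _ = _ := by ring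

lemma star (hF : ImBound s F α β) : ImBound s ((starRingEnd ℂ) F) α β := by
  refine ⟨by simpa using hF.1, by simpa using hF.2⟩

lemma mono (hF : ImBound s F α β) (hs : 0 ≤ s) (hα : α ≤ α') (hβ : β ≤ β') :
    ImBound s F α' β' :=
  ⟨hF.1.trans hα, hF.2.trans (mul_le_mul_of_nonneg_right hβ hs)⟩

lemma const_mul (hF : ImBound s F α β) (r : ℝ) :
    ImBound s ((r : ℂ) * F) (|r| * α) (|r| * β) := by
  simpa using (ImBound.ofReal r s).mul hF

end ImBound

lemma abs_im_pow_succ_le {q : ℂ} {p : ℝ} (hp : ‖q‖ ≤ p) (hs : 0 ≤ q.im) (n : ℕ) :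
    |(q ^ (n + 1)).im| ≤ (n + 1) * p ^ n * q.im := by
  have hp0 : 0 ≤ p := (norm_nonneg _).trans hp
  induction n with
  | zero => simp [abs_of_nonneg hs]
  | succ n ih =>
    rw [pow_succ, mul_im]
    calc |(q ^ (n + 1)).re * q.im + (q ^ (n + 1)).im * q.re|
        ≤ |(q ^ (n + 1)).re| * |q.im| + |(q ^ (n + 1)).im| * |q.re| := by
          rw [← abs_mul, ← abs_mul]; exact abs_add_le _ _
      _ ≤ p ^ (n + 1) * q.im + ((n + 1) * p ^ n * q.im) * p := by
          have h1 : |(q ^ (n + 1)).re| ≤ p ^ (n + 1) :=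
            (abs_re_le_norm _).trans (by rw [norm_pow]; gcongr)
          rw [abs_of_nonneg hs]
          gcongr
          exact (abs_re_le_norm _).trans hp
      _ = _ := by push_cast; ring

/-- A power series with real coefficients `0 ≤ a n ≤ C 6ⁿ`, on the upper half of the disc
`|q| ≤ 1/230`. -/
lemma imBound_tsum {a : ℕ → ℝ} {C : ℝ} (ha0 : ∀ n, 0 ≤ a n) (ha : ∀ n, a n ≤ C * 6 ^ n)
    {q : ℂ} (hq : ‖q‖ ≤ 1 / 230) (hs : 0 ≤ q.im) :
    ImBound q.im (∑' n, (a n : ℂ) * q ^ n) (1.03 * C) (6.4 * C) := by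
  have hC : 0 ≤ C := by simpa using (ha0 0).trans (ha 0)
  have hnorm : ∀ n, ‖(a n : ℂ) * q ^ n‖ ≤ C * (6 / 230) ^ n := fun n => by
    rw [norm_mul, norm_real, Real.norm_of_nonneg (ha0 n), norm_pow]
    calc a n * ‖q‖ ^ n ≤ (C * 6 ^ n) * (1 / 230) ^ n := by
          have := ha n
          have := ha0 n
          gcongr
      _ = C * (6 / 230) ^ n := by rw [mul_assoc, ← mul_pow]; norm_num
  have hgeo : HasSum (fun n : ℕ => C * (6 / 230 : ℝ) ^ n) (C * (1 - 6 / 230)⁻¹) :=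
    (hasSum_geometric_of_lt_one (by norm_num) (by norm_num)).mul_left C
  have hsum : Summable fun n => (a n : ℂ) * q ^ n := .of_norm_bounded hgeo.summable hnorm
  constructor
  · refine (tsum_of_norm_bounded hgeo hnorm).trans ?_
    norm_num
    linarith
  · have him : HasSum (fun n => ((a n : ℂ) * q ^ n).im) (∑' n, (a n : ℂ) * q ^ n).im :=
      hasSum_im hsum.hasSum
    have hr : ‖(6 / 230 : ℝ)‖ < 1 := by norm_num
    have hgeo2 : HasSum (fun n : ℕ => C * q.im * 230 * (n * (6 / 230 : ℝ) ^ n))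
        (C * q.im * 230 * ((6 / 230) / (1 - 6 / 230) ^ 2)) :=
      (hasSum_coe_mul_geometric_of_norm_lt_one hr).mul_left (C * q.im * 230)
    have hb : ∀ n, ‖((a n : ℂ) * q ^ n).im‖ ≤ C * q.im * 230 * (n * (6 / 230 : ℝ) ^ n) := by
      intro n
      rw [im_ofReal_mul, norm_mul, Real.norm_of_nonneg (ha0 n), Real.norm_eq_abs]
      cases n with
      | zero => simp
      | succ n =>
        have h1 := abs_im_pow_succ_le hq hs n
        have h2 := ha (n + 1)
        have h3 : (230 : ℝ) * (6 / 230) ^ (n + 1) = 6 ^ (n + 1) * (1 / 230) ^ n := by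
          rw [div_eq_mul_one_div (6 : ℝ) 230, mul_pow, pow_succ (1 / 230 : ℝ)]; ring
        calc a (n + 1) * |(q ^ (n + 1)).im|
            ≤ (C * 6 ^ (n + 1)) * ((n + 1) * (1 / 230) ^ n * q.im) :=
              mul_le_mul h2 h1 (abs_nonneg _) ((ha0 _).trans h2)
          _ = C * q.im * (n + 1) * (6 ^ (n + 1) * (1 / 230) ^ n) := by ring
          _ = _ := by rw [← h3]; push_cast; ring
    have := tsum_of_norm_bounded hgeo2 hb
    rw [him.tsum_eq, Real.norm_eq_abs] at this
    refine this.trans ?_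
    have : 0 ≤ C * q.im := by positivity
    norm_num
    linarith

/-- The series `∑ nᵏ σ₅(n) qⁿ`. -/
noncomputable def sigmaSeries (k : ℕ) (q : ℂ) : ℂ :=
  ∑' n : ℕ, (n : ℂ) ^ k * (ArithmeticFunction.sigma 5 n : ℂ) * q ^ n

lemma sigma_five_le (n : ℕ) : (ArithmeticFunction.sigma 5 n : ℝ) ≤ (n : ℝ) ^ 6 := by
  exact_mod_cast ArithmeticFunction.sigma_le_pow_succ 5 n

lemma summable_pow_mul_sigma (k : ℕ) {r : ℝ} (hr0 : 0 ≤ r) (hr : r < 1) :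
    Summable fun n : ℕ => (n : ℝ) ^ k * (ArithmeticFunction.sigma 5 n : ℝ) * r ^ n := by
  refine Summable.of_nonneg_of_le (fun n => by positivity) (fun n => ?_)
    (summable_pow_mul_geometric_of_norm_lt_one (k + 6)
      (r := r) (by rwa [Real.norm_of_nonneg hr0]))
  rw [pow_add]
  have := sigma_five_le n
  gcongr

lemma norm_sigmaSeries_term (k : ℕ) (q : ℂ) (n : ℕ) :
    ‖(n : ℂ) ^ k * (ArithmeticFunction.sigma 5 n : ℂ) * q ^ n‖ =
      (n : ℝ) ^ k * (ArithmeticFunction.sigma 5 n : ℝ) * ‖q‖ ^ n := by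
  simp

lemma summable_sigmaSeries (k : ℕ) {q : ℂ} (hq : ‖q‖ < 1) :
    Summable fun n : ℕ => (n : ℂ) ^ k * (ArithmeticFunction.sigma 5 n : ℂ) * q ^ n := by
  refine Summable.of_norm ?_
  simpa only [norm_sigmaSeries_term] using summable_pow_mul_sigma k (norm_nonneg q) hq

lemma sigmaSeries_conj (k : ℕ) (q : ℂ) :
    sigmaSeries k ((starRingEnd ℂ) q) = (starRingEnd ℂ) (sigmaSeries k q) := by
  simp [sigmaSeries, Complex.conj_tsum]

/-- The series `∑ (n+4)ᵏ σ₅(n+4) qⁿ`, so that `q⁴` times it is a tail of `sigmaSeries k`. -/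
noncomputable def sigmaTail (k : ℕ) (q : ℂ) : ℂ :=
  ∑' n : ℕ, (((n + 4 : ℕ) : ℝ) ^ k * (ArithmeticFunction.sigma 5 (n + 4) : ℝ) : ℝ) * q ^ n

lemma sigmaSeries_eq (k : ℕ) {q : ℂ} (hq : ‖q‖ < 1) :
    sigmaSeries k q = q + 2 ^ k * 33 * q ^ 2 + 3 ^ k * 244 * q ^ 3 + q ^ 4 * sigmaTail k q := by
  rw [sigmaSeries, ← (summable_sigmaSeries k hq).sum_add_tsum_nat_add 4, sigmaTail,
    ← tsum_mul_left]
  have h1 : ArithmeticFunction.sigma 5 1 = 1 := by decide +kernel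
  have h2 : ArithmeticFunction.sigma 5 2 = 33 := by decide +kernel
  have h3 : ArithmeticFunction.sigma 5 3 = 244 := by decide +kernel
  simp only [Finset.sum_range_succ, Finset.sum_range_zero, h1, h2, h3]
  simp only [ArithmeticFunction.map_zero]
  push_cast
  congr 1
  · simp
  · refine tsum_congr fun n => ?_
    rw [pow_add]; ring

lemma imBound_sigmaTail {k : ℕ} (hk : k ≤ 2) {q : ℂ} (hq : ‖q‖ ≤ 1 / 230) (hs : 0 ≤ q.im) :
    ImBound q.im (sigmaTail k q) (1.03 * 4 ^ (6 + k)) (6.4 * 4 ^ (6 + k)) := by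
  refine imBound_tsum (fun n => by positivity) (fun n => ?_) hq hs
  calc ((n + 4 : ℕ) : ℝ) ^ k * (ArithmeticFunction.sigma 5 (n + 4) : ℝ)
      ≤ ((n + 4 : ℕ) : ℝ) ^ k * ((n + 4 : ℕ) : ℝ) ^ 6 := by
        gcongr; exact sigma_five_le _
    _ = ((n + 4 : ℕ) : ℝ) ^ (6 + k) := by rw [pow_add, mul_comm]
    _ ≤ 4 ^ (6 + k) * 6 ^ n := by
        induction n with
        | zero => simp
        | succ n ih =>
          have hn : ((n + 1 + 4 : ℕ) : ℝ) ≤ 5 / 4 * ((n + 4 : ℕ) : ℝ) := by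
            push_cast; linarith [(Nat.cast_nonneg n : (0 : ℝ) ≤ n)]
          calc ((n + 1 + 4 : ℕ) : ℝ) ^ (6 + k) ≤ (5 / 4 * ((n + 4 : ℕ) : ℝ)) ^ (6 + k) := by gcongr
            _ = (5 / 4) ^ (6 + k) * ((n + 4 : ℕ) : ℝ) ^ (6 + k) := by rw [mul_pow]
            _ ≤ 6 * (4 ^ (6 + k) * 6 ^ n) := by
                gcongr
                interval_cases k <;> norm_num
            _ = _ := by ring

/-- Termwise differentiation in `τ` of `∑ nᵏ σ₅(n) qⁿ`, `q = exp (2πiτ)`. -/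
lemma hasDerivAt_sigmaSeries (k : ℕ) {z : ℂ} (hz : 0 < z.im) :
    HasDerivAt (fun w : ℂ => sigmaSeries k (exp (2 * Real.pi * I * w)))
      (2 * Real.pi * I * sigmaSeries (k + 1) (exp (2 * Real.pi * I * z))) z := by
  set U : Set ℂ := {w | z.im / 2 < w.im} with hU
  have hUo : IsOpen U := isOpen_lt continuous_const continuous_im
  have hzU : z ∈ U := by simp only [hU, Set.mem_ofPred_eq]; linarith
  set r : ℝ := Real.exp (-(Real.pi * z.im)) with hr
  have hr1 : r < 1 := by
    rw [hr, Real.exp_lt_one_iff]; have := Real.pi_pos; nlinarith [mul_pos this hz]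
  have hnorm : ∀ w ∈ U, ‖exp (2 * Real.pi * I * w)‖ ≤ r := by
    intro w hw
    rw [norm_exp, hr]
    apply Real.exp_le_exp.mpr
    have : z.im / 2 < w.im := hw
    have h2 : (2 * (Real.pi : ℂ) * I * w).re = -(2 * Real.pi * w.im) := by
      simp
    rw [h2]
    nlinarith [Real.pi_pos]
  let f : ℕ → ℂ → ℂ := fun n w =>
    (n : ℂ) ^ k * (ArithmeticFunction.sigma 5 n : ℂ) * exp (2 * Real.pi * I * w) ^ n
  have hd : ∀ n w, HasDerivAt (f n) (2 * Real.pi * I * ((n : ℂ) ^ (k + 1) *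
      (ArithmeticFunction.sigma 5 n : ℂ) * exp (2 * Real.pi * I * w) ^ n)) w := by
    intro n w
    have h1 : HasDerivAt (fun w : ℂ => 2 * (Real.pi : ℂ) * I * w) (2 * Real.pi * I) w := by
      simpa using (hasDerivAt_id w).const_mul (2 * (Real.pi : ℂ) * I)
    refine ((h1.cexp.pow n).const_mul ((n : ℂ) ^ k *
      (ArithmeticFunction.sigma 5 n : ℂ))).congr_deriv ?_
    cases n with
    | zero => simp
    | succ n => simp; ring
  have hu := summable_pow_mul_sigma k (Real.exp_nonneg _) hr1
  have hb : ∀ n, ∀ w ∈ U, ‖f n w‖ ≤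
      (n : ℝ) ^ k * (ArithmeticFunction.sigma 5 n : ℝ) * r ^ n := by
    intro n w hw
    rw [norm_sigmaSeries_term]
    have := hnorm w hw
    gcongr
  have hdiff : ∀ n, DifferentiableOn ℂ (f n) U := fun n w _ =>
    (hd n w).differentiableAt.differentiableWithinAt
  have hs := hasSum_deriv_of_summable_norm hu hdiff hUo hb hzU
  have hdo := (differentiableOn_tsum_of_summable_norm hu hdiff hUo hb).differentiableAt
    (hUo.mem_nhds hzU)
  refine hdo.hasDerivAt.congr_deriv ?_
  rw [← hs.tsum_eq]
  simp only [(hd _ z).deriv]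
  rw [tsum_mul_left]; rfl

/-! ### Estimates on the half-disc `|q| ≤ 1/230`, `Im q ≥ 0` -/

section HalfDisc

variable {q t₀ t₁ t₂ : ℂ}

/-- `G(q) / q` for `G = ∑ n σ₅(n) qⁿ`, where the terms from `n = 4` on sum to `q⁴ t`. -/
def seriesW (q t : ℂ) : ℂ := 1 + 66 * q + 732 * q ^ 2 + q ^ 3 * t

/-- `H(q) / q` for `H = ∑ n² σ₅(n) qⁿ`, where the terms from `n = 4` on sum to `q⁴ t`. -/
def seriesV (q t : ℂ) : ℂ := 1 + 132 * q + 2196 * q ^ 2 + q ^ 3 * t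

/-- `E₆ = 1 - 504 ∑ σ₅(n) qⁿ`, where the terms of the sum from `n = 4` on add up to `q⁴ t`. -/
def seriesE (q t : ℂ) : ℂ := 1 - 504 * (q + 33 * q ^ 2 + 244 * q ^ 3 + q ^ 4 * t)

lemma norm_seriesW_sub_one_le (hq : ‖q‖ ≤ 1 / 230) (ht : ‖t₁‖ ≤ 16876) :
    ‖seriesW q t₁ - 1‖ ≤ 0.303 := by
  have : seriesW q t₁ - 1 = q * (66 + q * (732 + q * t₁)) := by rw [seriesW]; ring
  rw [this, norm_mul]
  have h1 : ‖q * t₁‖ ≤ 1 / 230 * 16876 := by rw [norm_mul]; gcongr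
  have h2 : ‖732 + q * t₁‖ ≤ 732 + 1 / 230 * 16876 :=
    (norm_add_le _ _).trans (add_le_add (by simp) h1)
  have h3 : ‖q * (732 + q * t₁)‖ ≤ 1 / 230 * (732 + 1 / 230 * 16876) := by
    rw [norm_mul]; gcongr
  have h4 : ‖66 + q * (732 + q * t₁)‖ ≤ 66 + 1 / 230 * (732 + 1 / 230 * 16876) :=
    (norm_add_le _ _).trans (add_le_add (by simp) h3)
  calc ‖q‖ * ‖66 + q * (732 + q * t₁)‖
      ≤ 1 / 230 * (66 + 1 / 230 * (732 + 1 / 230 * 16876)) := by gcongr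
    _ ≤ _ := by norm_num

lemma le_norm_seriesW (hq : ‖q‖ ≤ 1 / 230) (ht : ‖t₁‖ ≤ 16876) :
    0.697 ≤ ‖seriesW q t₁‖ := by
  have h := norm_seriesW_sub_one_le hq ht
  have h2 : ‖(1 : ℂ)‖ ≤ ‖seriesW q t₁‖ + ‖seriesW q t₁ - 1‖ := by
    simpa using norm_sub_le (seriesW q t₁) (seriesW q t₁ - 1)
  rw [norm_one] at h2
  linarith

lemma seriesW_ne_zero (hq : ‖q‖ ≤ 1 / 230) (ht : ‖t₁‖ ≤ 16876) : seriesW q t₁ ≠ 0 := by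
  have := le_norm_seriesW hq ht
  rw [← norm_pos_iff]; linarith

lemma imBound_self (hq : ‖q‖ ≤ 1 / 230) (hs : 0 ≤ q.im) : ImBound q.im q (1 / 230) 1 :=
  ⟨hq, by rw [abs_of_nonneg hs, one_mul]⟩

lemma imBound_seriesW (hq : ‖q‖ ≤ 1 / 230) (hs : 0 ≤ q.im) (h1 : ImBound q.im t₁ 16876 104858) :
    ImBound q.im (seriesW q t₁) 1.303 73.4 := by
  have hq' := imBound_self hq hs
  have := (ImBound.ofReal 1 q.im).add (hq'.mul ((ImBound.ofReal 66 q.im).add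
    (hq'.mul ((ImBound.ofReal 732 q.im).add (hq'.mul h1)))))
  convert this.mono hs (α' := 1.303) (β' := 73.4) (by norm_num) (by norm_num) using 1
  rw [seriesW]; push_cast; ring

/-- The quotient `(E - (1 - 570q) W - 20256 q²) / q³`. -/
def remainderK (q t₀ t₁ : ℂ) : ℂ := 294264 - t₁ + q * (570 * t₁ - 504 * t₀)

lemma imBound_remainderK (hq : ‖q‖ ≤ 1 / 230) (hs : 0 ≤ q.im)
    (h0 : ImBound q.im t₀ 4219 26215) (h1 : ImBound q.im t₁ 16876 104858) :
    ImBound q.im (remainderK q t₀ t₁) 363000 12200000 := by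
  have hq' := imBound_self hq hs
  have := ((ImBound.ofReal 294264 q.im).add (h1.const_mul (-1))).add
    (hq'.mul ((h1.const_mul 570).add (h0.const_mul (-504))))
  convert this.mono hs (α' := 363000) (β' := 12200000) (by norm_num) (by norm_num) using 1
  rw [remainderK]; push_cast; ring

lemma seriesE_eq : seriesE q t₀ =
    (1 - 570 * q) * seriesW q t₁ + q ^ 2 * (20256 + q * remainderK q t₀ t₁) := by
  rw [seriesE, seriesW, remainderK]; ring

lemma div_im_eq (z w : ℂ) : (z / w).im = (z * (starRingEnd ℂ) w).im / ‖w‖ ^ 2 := by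
  rw [← normSq_eq_norm_sq, div_eq_mul_inv, inv_def, ← mul_assoc, im_mul_ofReal, div_eq_mul_inv]

lemma inv_im_eq (z : ℂ) : (1 / z).im = - z.im / ‖z‖ ^ 2 := by
  rw [div_im_eq]; simp

lemma im_normSq_mul (p : ℝ) (z : ℂ) : ((p : ℂ) ^ 2 * z).im = p ^ 2 * z.im := by
  rw [← ofReal_pow, im_ofReal_mul]

lemma seriesE_div_eq (hq0 : q ≠ 0) (hW : seriesW q t₁ ≠ 0) :
    seriesE q t₀ / (q * seriesW q t₁) =
      1 / q - 570 + q * (20256 + q * remainderK q t₀ t₁) / seriesW q t₁ := by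
  rw [seriesE_eq (t₁ := t₁)]; field_simp

/-- Upper bound for `Im (E₆ / G)`, where `E₆ / G = 1/q - 570 + q (20256 + qK) / W`. In
`Im (q (20256 + qK) W̄)` the term `q q̄` is real, which leaves only contributions of higher
order. -/
lemma im_seriesE_div_lt (hq : ‖q‖ ≤ 1 / 230) (hs : 0 < q.im)
    (h0 : ImBound q.im t₀ 4219 26215) (h1 : ImBound q.im t₁ 16876 104858) :
    (seriesE q t₀ / (q * seriesW q t₁)).im < 19320 * q.im := by
  have hq0 : q ≠ 0 := by rintro rfl; simp at hs
  have hW := seriesW_ne_zero hq h1.1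
  have hW' := le_norm_seriesW hq h1.1
  have hq' := imBound_self hq hs.le
  set W := seriesW q t₁ with hWdef
  set K := remainderK q t₀ t₁ with hKdef
  have hp : 0 < ‖q‖ := norm_pos_iff.mpr hq0
  rw [seriesE_div_eq hq0 hW, ← hKdef, add_im, sub_im, inv_im_eq, div_im_eq]
  have e : q * (20256 + q * K) * (starRingEnd ℂ) W =
      ((20256 : ℝ) : ℂ) * (q + ((‖q‖ : ℝ) : ℂ) ^ 2 *
        (((66 : ℝ) : ℂ) + (starRingEnd ℂ) q * (((732 : ℝ) : ℂ) +
          (starRingEnd ℂ) q * (starRingEnd ℂ) t₁)))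
      + q * (q * (K * (starRingEnd ℂ) W)) := by
    rw [← mul_conj', hWdef, seriesW]
    simp only [map_add, map_mul, map_pow, map_one, map_ofNat]
    push_cast; ring
  have b1 := ((ImBound.ofReal 66 q.im).add (hq'.star.mul ((ImBound.ofReal 732 q.im).add
    (hq'.star.mul h1.star)))).mono hs.le (α' := 100) (β' := 1400) (by norm_num) (by norm_num)
  have b2 := (hq'.mul (hq'.mul ((imBound_remainderK hq hs.le h0 h1).mul
    (imBound_seriesW hq hs.le h1).star))).mono hs.le (α' := 100) (β' := 4960) (by norm_num)
    (by norm_num)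
  rw [← hKdef, ← hWdef] at b2
  have b3 := (abs_le.mp b2.2).2
  have b4 := (abs_le.mp b1.2).2
  have hp2 : ‖q‖ ^ 2 ≤ 1 / 52900 := by nlinarith
  rw [e, add_im, im_ofReal_mul, add_im, im_normSq_mul]
  have hA : 20256 * (q.im + ‖q‖ ^ 2 * ((((66 : ℝ) : ℂ) + (starRingEnd ℂ) q * (((732 : ℝ) : ℂ) +
          (starRingEnd ℂ) q * (starRingEnd ℂ) t₁)).im)) +
      (q * (q * (K * (starRingEnd ℂ) W))).im ≤ 25800 * q.im := by
    have : ‖q‖ ^ 2 * ((((66 : ℝ) : ℂ) + (starRingEnd ℂ) q * (((732 : ℝ) : ℂ) +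
          (starRingEnd ℂ) q * (starRingEnd ℂ) t₁)).im) ≤ 1 / 52900 * (1400 * q.im) :=
      (mul_le_mul_of_nonneg_left b4 (by positivity)).trans
        (mul_le_mul_of_nonneg_right hp2 (by positivity))
    linarith
  have hB : 0.485 ≤ ‖W‖ ^ 2 := by nlinarith
  have hC : (20256 * (q.im + ‖q‖ ^ 2 * ((((66 : ℝ) : ℂ) + (starRingEnd ℂ) q * (((732 : ℝ) : ℂ) +
          (starRingEnd ℂ) q * (starRingEnd ℂ) t₁)).im)) +
      (q * (q * (K * (starRingEnd ℂ) W))).im) / ‖W‖ ^ 2 ≤ 53300 * q.im := by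
    rw [div_le_iff₀ (by positivity)]
    nlinarith [mul_le_mul_of_nonneg_left hB hs.le]
  have hD : 52900 * q.im ≤ q.im / ‖q‖ ^ 2 := by
    rw [le_div_iff₀ (by positivity)]
    nlinarith [mul_le_mul_of_nonneg_left hp2 hs.le]
  have h570 : (570 : ℂ).im = 0 := by simp
  rw [neg_div, h570]
  linarith

lemma norm_seriesE_div_sub_le (hq0 : q ≠ 0) (hq : ‖q‖ ≤ 1 / 230) (ht0 : ‖t₀‖ ≤ 4219)
    (ht1 : ‖t₁‖ ≤ 16876) :
    ‖seriesE q t₀ / (q * seriesW q t₁) - (1 / q - 570)‖ ≤ 170 := by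
  have hW := seriesW_ne_zero hq ht1
  have hW' := le_norm_seriesW hq ht1
  rw [seriesE_div_eq hq0 hW, add_sub_cancel_left, norm_div, div_le_iff₀ (by linarith), norm_mul]
  have hK : ‖remainderK q t₀ t₁‖ ≤ 363000 := by
    rw [remainderK]
    have a1 : ‖570 * t₁ - 504 * t₀‖ ≤ 570 * 16876 + 504 * 4219 := by
      refine (norm_sub_le _ _).trans ?_
      rw [norm_mul, norm_mul]
      norm_num
      linarith
    have a2 : ‖q * (570 * t₁ - 504 * t₀)‖ ≤ 1 / 230 * (570 * 16876 + 504 * 4219) := by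
      rw [norm_mul]; gcongr
    have a3 : ‖(294264 : ℂ) - t₁‖ ≤ 294264 + 16876 :=
      (norm_sub_le _ _).trans (add_le_add (by simp) ht1)
    refine (norm_add_le _ _).trans ((add_le_add a3 a2).trans ?_)
    norm_num
  have a4 : ‖20256 + q * remainderK q t₀ t₁‖ ≤ 20256 + 1 / 230 * 363000 := by
    refine (norm_add_le _ _).trans (add_le_add (by simp) ?_)
    rw [norm_mul]; gcongr
  calc ‖q‖ * ‖20256 + q * remainderK q t₀ t₁‖ ≤ 1 / 230 * (20256 + 1 / 230 * 363000) := by gcongr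
    _ ≤ 170 * 0.697 := by norm_num
    _ ≤ _ := by gcongr

/-- The quotient `((1 - 504q) W² - E V - 20256 q²) / q³`. -/
def remainderM (q t₀ t₁ t₂ : ℂ) : ℂ :=
  588528 - t₂ + 2 * t₁ + q * (4594032 + 504 * t₂ - 876 * t₁ + 504 * t₀
    + q * (16632 * t₂ - 65064 * t₁ + 66528 * t₀
    + q * (122976 * t₂ - 737856 * t₁ + t₁ * t₁ + 1106784 * t₀
    + q * (504 * (t₀ * t₂) - 504 * (t₁ * t₁)))))

lemma remainderM_spec : (1 - 504 * q) * seriesW q t₁ ^ 2 - seriesE q t₀ * seriesV q t₂ =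
    q ^ 2 * (20256 + q * remainderM q t₀ t₁ t₂) := by
  rw [seriesW, seriesE, seriesV, remainderM]; ring

lemma imBound_remainderM (hq : ‖q‖ ≤ 1 / 230) (hs : 0 ≤ q.im)
    (h0 : ImBound q.im t₀ 4219 26215) (h1 : ImBound q.im t₁ 16876 104858)
    (h2 : ImBound q.im t₂ 67503 419431) :
    ImBound q.im (remainderM q t₀ t₁ t₂) 981200 81400000 := by
  have hq' := imBound_self hq hs
  have b4 := (((h0.mul h2).const_mul 504).add ((h1.mul h1).const_mul (-504))).mono hs
    (α' := 2.9e11) (β' := 3.6e12) (by norm_num) (by norm_num)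
  have b3 := (((((h2.const_mul 122976).add (h1.const_mul (-737856))).add (h1.mul h1)).add
    (h0.const_mul 1106784)).add (hq'.mul b4)).mono hs
    (α' := 2.7e10) (β' := 4.8e11) (by norm_num) (by norm_num)
  have b2 := ((((h2.const_mul 16632).add (h1.const_mul (-65064))).add
    (h0.const_mul 66528)).add (hq'.mul b3)).mono hs
    (α' := 2.63e9) (β' := 4.47e10) (by norm_num) (by norm_num)
  have b1 := (((((ImBound.ofReal 4594032 q.im).add (h2.const_mul 504)).add
    (h1.const_mul (-876))).add (h0.const_mul 504)).add (hq'.mul b2)).mono hs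
    (α' := 6.7e7) (β' := 3.15e9) (by norm_num) (by norm_num)
  have b0 := ((((ImBound.ofReal 588528 q.im).add (h2.const_mul (-1))).add
    (h1.const_mul 2)).add (hq'.mul b1)).mono hs
    (α' := 981200) (β' := 81400000) (by norm_num) (by norm_num)
  convert b0 using 1
  rw [remainderM]; push_cast; ring

/-- The quotient `(W² - 1 - 132q) / q²`. -/
def remainderY (q t₁ : ℂ) : ℂ :=
  5820 + q * (96624 + 2 * t₁ + q * (535824 + 132 * t₁ + q * (1464 * t₁ + q * (t₁ * t₁))))

lemma seriesW_sq : seriesW q t₁ ^ 2 = 1 + 132 * q + q ^ 2 * remainderY q t₁ := by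
  rw [seriesW, remainderY]; ring

lemma imBound_remainderY (hq : ‖q‖ ≤ 1 / 230) (hs : 0 ≤ q.im)
    (h1 : ImBound q.im t₁ 16876 104858) :
    ImBound q.im (remainderY q t₁) 6450 157300 := by
  have hq' := imBound_self hq hs
  have b3 := ((h1.const_mul 1464).add (hq'.mul (h1.mul h1))).mono hs
    (α' := 2.6e7) (β' := 4.6e8) (by norm_num) (by norm_num)
  have b2 := (((ImBound.ofReal 535824 q.im).add (h1.const_mul 132)).add (hq'.mul b3)).mono hs
    (α' := 2.9e6) (β' := 4.2e7) (by norm_num) (by norm_num)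
  have b0 := (((ImBound.ofReal 5820 q.im)).add (hq'.mul (((ImBound.ofReal 96624 q.im).add
    (h1.const_mul 2)).add (hq'.mul b2)))).mono hs
    (α' := 6450) (β' := 157300) (by norm_num) (by norm_num)
  convert b0 using 1
  rw [remainderY]; push_cast; ring

/-- The sign of `Im (E₆ H / G²)`, where `E₆ H / G² = 1/q - 504 - q (20256 + qM) / W²`. The term
`-Im q / |q|²` coming from `1/q` is negative, and `Im (q (20256 + qM) W̄²)` cannot compensate it, as
its leading term `20256 Im q` is positive. -/
lemma im_seriesE_mul_seriesV_div_neg (hq : ‖q‖ ≤ 1 / 230) (hs : 0 < q.im)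
    (h0 : ImBound q.im t₀ 4219 26215) (h1 : ImBound q.im t₁ 16876 104858)
    (h2 : ImBound q.im t₂ 67503 419431) :
    (seriesE q t₀ * seriesV q t₂ / (q * seriesW q t₁ ^ 2)).im < 0 := by
  have hq0 : q ≠ 0 := by rintro rfl; simp at hs
  have hW := seriesW_ne_zero hq h1.1
  have hW' := le_norm_seriesW hq h1.1
  have hq' := imBound_self hq hs.le
  set W := seriesW q t₁ with hWdef
  set M := remainderM q t₀ t₁ t₂ with hMdef
  have hp : 0 < ‖q‖ := norm_pos_iff.mpr hq0
  have e0 : seriesE q t₀ * seriesV q t₂ / (q * W ^ 2) =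
      1 / q - 504 - q * (20256 + q * M) / W ^ 2 := by
    have := remainderM_spec (q := q) (t₀ := t₀) (t₁ := t₁) (t₂ := t₂)
    rw [← hWdef, ← hMdef] at this
    rw [show seriesE q t₀ * seriesV q t₂ = (1 - 504 * q) * W ^ 2 - q ^ 2 * (20256 + q * M) by
      rw [← this]; ring]
    field_simp
  rw [e0, sub_im, sub_im, inv_im_eq, div_im_eq]
  have e : q * (20256 + q * M) * (starRingEnd ℂ) (W ^ 2) =
      ((20256 : ℝ) : ℂ) * (q + ((‖q‖ : ℝ) : ℂ) ^ 2 *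
        (((132 : ℝ) : ℂ) + (starRingEnd ℂ) q * (starRingEnd ℂ) (remainderY q t₁)))
      + q * (q * (M * ((starRingEnd ℂ) W * (starRingEnd ℂ) W))) := by
    rw [← map_mul _ W W, ← pow_two W, ← mul_conj', hWdef, seriesW_sq]
    simp only [map_add, map_mul, map_pow, map_one, map_ofNat]
    push_cast; ring
  have b1 := ((ImBound.ofReal 132 q.im).add (hq'.star.mul
    (imBound_remainderY hq hs.le h1).star)).mono hs.le (α' := 200) (β' := 7140)
    (by norm_num) (by norm_num)
  have hWb := (imBound_seriesW hq hs.le h1).star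
  have b2 := (hq'.mul (hq'.mul ((imBound_remainderM hq hs.le h0 h1 h2).mul
    (hWb.mul hWb)))).mono hs.le (α' := 100) (β' := 20800) (by norm_num) (by norm_num)
  rw [← hMdef, ← hWdef] at b2
  have b3 := (abs_le.mp b2.2).1
  have b4 := (abs_le.mp b1.2).1
  have hp2 : ‖q‖ ^ 2 ≤ 1 / 52900 := by nlinarith
  rw [e, add_im, im_ofReal_mul, add_im, im_normSq_mul]
  set Z := (((132 : ℝ) : ℂ) + (starRingEnd ℂ) q * (starRingEnd ℂ) (remainderY q t₁)).im
  set R := (q * (q * (M * ((starRingEnd ℂ) W * (starRingEnd ℂ) W)))).im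
  have hA : -3500 * q.im ≤ 20256 * (q.im + ‖q‖ ^ 2 * Z) + R := by
    have : ‖q‖ ^ 2 * (-Z) ≤ 1 / 52900 * (7140 * q.im) :=
      (mul_le_mul_of_nonneg_left (by linarith : -Z ≤ 7140 * q.im) (by positivity)).trans
        (mul_le_mul_of_nonneg_right hp2 (by positivity))
    linarith
  have hB : 0.23 ≤ ‖W ^ 2‖ ^ 2 := by
    have h4 : 0.485 ≤ ‖W‖ ^ 2 := by nlinarith
    rw [norm_pow]
    nlinarith
  have hC : -20000 * q.im ≤ (20256 * (q.im + ‖q‖ ^ 2 * Z) + R) / ‖W ^ 2‖ ^ 2 := by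
    rw [le_div_iff₀ (by linarith)]
    nlinarith [mul_le_mul_of_nonneg_left hB hs.le]
  have hD : 52900 * q.im ≤ q.im / ‖q‖ ^ 2 := by
    rw [le_div_iff₀ (by positivity)]
    nlinarith [mul_le_mul_of_nonneg_left hp2 hs.le]
  have h504 : (504 : ℂ).im = 0 := by simp
  rw [neg_div, h504]
  linarith

end HalfDisc

/-! ### The function `h` on the half-strip -/

/-- The nome `q = exp (2πiz)`. -/
noncomputable def nome (z : ℂ) : ℂ := exp (2 * Real.pi * I * z)

/-- `E₆` as a function of a complex variable, given by its `q`-expansion. -/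
noncomputable def e6 (z : ℂ) : ℂ := 1 - 504 * sigmaSeries 0 (nome z)

/-- The function `h(z) = z + 6 E₆(z) / E₆'(z)`, with `E₆' = -1008πi ∑ n σ₅(n) qⁿ`. -/
noncomputable def hFun (z : ℂ) : ℂ := z + I / (168 * Real.pi) * (e6 z / sigmaSeries 1 (nome z))

lemma norm_nome (z : ℂ) : ‖nome z‖ = Real.exp (-(2 * Real.pi * z.im)) := by
  rw [nome, norm_exp]; congr 1; simp

lemma nome_ne_zero (z : ℂ) : nome z ≠ 0 := exp_ne_zero _

lemma nome_eq (z : ℂ) : nome z = (Real.exp (-(2 * Real.pi * z.im)) : ℂ) *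
    (Real.cos (2 * Real.pi * z.re) + Real.sin (2 * Real.pi * z.re) * I) := by
  rw [nome, ofReal_exp, ofReal_cos, ofReal_sin, ← exp_mul_I, ← exp_add]
  congr 1
  conv_lhs => rw [← re_add_im z]
  push_cast
  linear_combination (2 * (Real.pi : ℂ) * z.im) * I_sq

lemma nome_im (z : ℂ) : (nome z).im =
    Real.exp (-(2 * Real.pi * z.im)) * Real.sin (2 * Real.pi * z.re) := by
  rw [nome_eq, im_ofReal_mul, add_im, ofReal_im, im_ofReal_mul, I_im]; ring

lemma norm_nome_lt_one {z : ℂ} (hz : 0 < z.im) : ‖nome z‖ < 1 := by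
  rw [norm_nome, Real.exp_lt_one_iff]; have := Real.pi_pos; nlinarith [mul_pos this hz]

lemma le_exp_two_pi_mul {y : ℝ} (hy : Real.sqrt 3 / 2 ≤ y) :
    5.44 ≤ 2 * Real.pi * y ∧ 230 ≤ Real.exp (2 * Real.pi * y) := by
  have h3 : 1.732 ≤ Real.sqrt 3 := Real.le_sqrt_of_sq_le (by norm_num)
  have hpi := Real.pi_gt_d4
  have h1 : 5.44 ≤ 2 * Real.pi * y := by nlinarith
  refine ⟨h1, ?_⟩
  have he : (2.7182818283 : ℝ) ^ 5 ≤ Real.exp 5 := by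
    have : Real.exp 5 = Real.exp 1 ^ 5 := by rw [← Real.exp_nat_mul]; norm_num
    rw [this]; gcongr; exact Real.exp_one_gt_d9.le
  have he2 : 1.552 ≤ Real.exp 0.44 := by
    refine le_trans ?_ (Real.sum_le_exp_of_nonneg (by norm_num) 5)
    norm_num [Finset.sum_range_succ, Nat.factorial]
  calc (230 : ℝ) ≤ 2.7182818283 ^ 5 * 1.552 := by norm_num
    _ ≤ Real.exp 5 * Real.exp 0.44 := by gcongr
    _ = Real.exp 5.44 := by rw [← Real.exp_add]; norm_num
    _ ≤ _ := Real.exp_le_exp.mpr h1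

lemma norm_nome_le {z : ℂ} (hz : Real.sqrt 3 / 2 ≤ z.im) : ‖nome z‖ ≤ 1 / 230 := by
  rw [norm_nome, Real.exp_neg, inv_eq_one_div]
  exact one_div_le_one_div_of_le (by norm_num) (le_exp_two_pi_mul hz).2

lemma im_pos_of_le {z : ℂ} (hz : Real.sqrt 3 / 2 ≤ z.im) : 0 < z.im :=
  lt_of_lt_of_le (by positivity) hz

lemma nome_im_pos {z : ℂ} (h0 : 0 < z.re) (h1 : z.re < 1 / 2) : 0 < (nome z).im := by
  have := Real.pi_pos
  rw [nome_im]
  exact mul_pos (Real.exp_pos _) (Real.sin_pos_of_pos_of_lt_pi (by positivity) (by nlinarith))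

lemma nome_im_nonneg {z : ℂ} (h0 : 0 ≤ z.re) (h1 : z.re ≤ 1 / 2) : 0 ≤ (nome z).im := by
  have := Real.pi_pos
  rw [nome_im]
  exact mul_nonneg (Real.exp_pos _).le
    (Real.sin_nonneg_of_nonneg_of_le_pi (by positivity) (by nlinarith))

lemma imBound_tails {q : ℂ} (hq : ‖q‖ ≤ 1 / 230) (hs : 0 ≤ q.im) :
    ImBound q.im (sigmaTail 0 q) 4219 26215 ∧ ImBound q.im (sigmaTail 1 q) 16876 104858 ∧
      ImBound q.im (sigmaTail 2 q) 67503 419431 :=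
  ⟨(imBound_sigmaTail (k := 0) (by norm_num) hq hs).mono hs (by norm_num) (by norm_num),
    (imBound_sigmaTail (k := 1) (by norm_num) hq hs).mono hs (by norm_num) (by norm_num),
    (imBound_sigmaTail (k := 2) (by norm_num) hq hs).mono hs (by norm_num) (by norm_num)⟩

lemma e6_eq_seriesE {z : ℂ} (hz : 0 < z.im) :
    e6 z = seriesE (nome z) (sigmaTail 0 (nome z)) := by
  rw [e6, seriesE, sigmaSeries_eq 0 (norm_nome_lt_one hz)]; norm_num

lemma sigmaSeries_one_eq {q : ℂ} (hq : ‖q‖ < 1) :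
    sigmaSeries 1 q = q * seriesW q (sigmaTail 1 q) := by
  rw [seriesW, sigmaSeries_eq 1 hq]; ring

lemma sigmaSeries_two_eq {q : ℂ} (hq : ‖q‖ < 1) :
    sigmaSeries 2 q = q * seriesV q (sigmaTail 2 q) := by
  rw [seriesV, sigmaSeries_eq 2 hq]; ring

lemma sigmaSeries_one_ne_zero {z : ℂ} (hz : Real.sqrt 3 / 2 ≤ z.im) (h0 : 0 ≤ z.re)
    (h1 : z.re ≤ 1 / 2) : sigmaSeries 1 (nome z) ≠ 0 := by
  rw [sigmaSeries_one_eq (norm_nome_lt_one (im_pos_of_le hz))]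
  exact mul_ne_zero (nome_ne_zero z) (seriesW_ne_zero (norm_nome_le hz)
    (imBound_tails (norm_nome_le hz) (nome_im_nonneg h0 h1)).2.1.1)

lemma hasDerivAt_e6 {z : ℂ} (hz : 0 < z.im) :
    HasDerivAt e6 (-(1008 * Real.pi * I) * sigmaSeries 1 (nome z)) z := by
  refine (((hasDerivAt_sigmaSeries 0 hz).const_mul 504).const_sub 1).congr_deriv ?_
  rw [nome]; ring

lemma hasDerivAt_hFun {z : ℂ} (hz : 0 < z.im) (hG : sigmaSeries 1 (nome z) ≠ 0) :
    HasDerivAt hFun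
      (7 + e6 z * sigmaSeries 2 (nome z) / sigmaSeries 1 (nome z) ^ 2 / 84) z := by
  have h := (hasDerivAt_id z).add (((hasDerivAt_e6 hz).div (hasDerivAt_sigmaSeries 1 hz)
    hG).const_mul (I / (168 * Real.pi)))
  refine h.congr_deriv ?_
  have hpi : (Real.pi : ℂ) ≠ 0 := ofReal_ne_zero.mpr Real.pi_ne_zero
  change 1 + I / (168 * Real.pi) * ((-(1008 * Real.pi * I) * sigmaSeries 1 (nome z) *
    sigmaSeries 1 (nome z) - e6 z * (2 * Real.pi * I * sigmaSeries 2 (nome z))) /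
      sigmaSeries 1 (nome z) ^ 2) = _
  field_simp
  ring_nf
  rw [I_sq]
  ring

/-- The half-strip `0 < Re z < 1/2`, `Im z ≥ √3/2`. -/
def halfStrip : Set ℂ := {z | 0 < z.re ∧ z.re < 1 / 2 ∧ Real.sqrt 3 / 2 ≤ z.im}

lemma convex_halfStrip : Convex ℝ halfStrip :=
  (convex_halfSpace_re_gt 0).inter ((convex_halfSpace_re_lt (1 / 2)).inter
    (convex_halfSpace_im_ge (Real.sqrt 3 / 2)))

/-- `h' = 7 + E₆ H / (84 G²)` has negative imaginary part on the half-strip. -/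
lemma im_deriv_hFun_neg {z : ℂ} (hz : z ∈ halfStrip) :
    (7 + e6 z * sigmaSeries 2 (nome z) / sigmaSeries 1 (nome z) ^ 2 / 84).im < 0 := by
  obtain ⟨h0, h1, hy⟩ := hz
  have hq := norm_nome_le hy
  have hq1 := norm_nome_lt_one (im_pos_of_le hy)
  obtain ⟨t0, t1, t2⟩ := imBound_tails hq (nome_im_pos h0 h1).le
  have key := im_seriesE_mul_seriesV_div_neg hq (nome_im_pos h0 h1) t0 t1 t2
  rw [e6_eq_seriesE (im_pos_of_le hy), sigmaSeries_one_eq hq1, sigmaSeries_two_eq hq1]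
  have hq0 := nome_ne_zero z
  have hW := seriesW_ne_zero hq t1.1
  have e : ∀ A B W q : ℂ, q ≠ 0 → A * (q * B) / (q * W) ^ 2 = A * B / (q * W ^ 2) := by
    intro A B W q hq
    by_cases hW : W = 0
    · simp [hW]
    · field_simp
  rw [e _ _ _ _ hq0, add_im, show (84 : ℂ) = ((84 : ℝ) : ℂ) by norm_num, div_ofReal_im]
  have : (7 : ℂ).im = 0 := by simp
  rw [this]
  linarith

/-- `h` is injective, being a function on a convex set whose derivative takes values in a
half-plane. -/
lemma injOn_hFun : Set.InjOn hFun halfStrip := by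
  intro z₁ h₁ z₂ h₂ heq
  by_contra hne
  have hd : z₂ - z₁ ≠ 0 := sub_ne_zero.mpr (Ne.symm hne)
  have hmem : ∀ t ∈ Set.Icc (0 : ℝ) 1, z₁ + (t : ℂ) * (z₂ - z₁) ∈ halfStrip := fun t ht => by
    simpa using convex_halfStrip.add_smul_sub_mem h₁ h₂ ht
  -- The derivative of `t ↦ Im (h (z₁ + t (z₂ - z₁)) / (z₂ - z₁))` is `Im h' < 0`.
  let φ : ℝ → ℝ := fun t => (hFun (z₁ + (t : ℂ) * (z₂ - z₁)) / (z₂ - z₁)).im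
  have hφ : ∀ t ∈ Set.Icc (0 : ℝ) 1, ∃ c, c < 0 ∧ HasDerivAt φ c t := by
    intro t ht
    have hm := hmem t ht
    obtain ⟨m0, m1, m2⟩ := hm
    have hG := sigmaSeries_one_ne_zero m2 m0.le m1.le
    refine ⟨_, im_deriv_hFun_neg (hmem t ht), ?_⟩
    have hin : HasDerivAt (fun w : ℂ => z₁ + w * (z₂ - z₁)) (z₂ - z₁) (t : ℂ) := by
      simpa using ((hasDerivAt_id (t : ℂ)).mul_const (z₂ - z₁)).const_add z₁
    have hc := ((hasDerivAt_hFun (im_pos_of_le m2) hG).comp (t : ℂ) hin).div_const (z₂ - z₁)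
    rw [mul_div_cancel_right₀ _ hd] at hc
    exact imCLM.hasFDerivAt.comp_hasDerivAt t hc.comp_ofReal
  obtain ⟨c, hc, hc0⟩ := exists_deriv_eq_zero (f := φ) zero_lt_one
    (fun t ht => (hφ t ht).choose_spec.2.continuousAt.continuousWithinAt)
    (by simp [φ, heq])
  obtain ⟨d, hd0, hdd⟩ := hφ c ⟨hc.1.le, hc.2.le⟩
  rw [hdd.deriv] at hc0
  linarith

lemma continuousAt_hFun {z : ℂ} (hz : Real.sqrt 3 / 2 ≤ z.im) (h0 : 0 ≤ z.re)
    (h1 : z.re ≤ 1 / 2) : ContinuousAt hFun z :=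
  (hasDerivAt_hFun (im_pos_of_le hz) (sigmaSeries_one_ne_zero hz h0 h1)).continuousAt

lemma hFun_re (z : ℂ) :
    (hFun z).re = z.re - (e6 z / sigmaSeries 1 (nome z)).im / (168 * Real.pi) := by
  have : I / (168 * Real.pi) = ((1 / (168 * Real.pi) : ℝ) : ℂ) * I := by push_cast; ring
  rw [hFun, this, add_re, mul_assoc, re_ofReal_mul, I_mul_re]; ring

lemma hFun_im (z : ℂ) :
    (hFun z).im = z.im + (e6 z / sigmaSeries 1 (nome z)).re / (168 * Real.pi) := by
  have : I / (168 * Real.pi) = ((1 / (168 * Real.pi) : ℝ) : ℂ) * I := by push_cast; ring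
  rw [hFun, this, add_im, mul_assoc, im_ofReal_mul, I_mul_im]; ring

lemma hFun_re_pos {z : ℂ} (hz : z ∈ halfStrip) : 0 < (hFun z).re := by
  obtain ⟨h0, h1, hy⟩ := hz
  have hq := norm_nome_le hy
  have hs := nome_im_pos h0 h1
  obtain ⟨t0, t1, t2⟩ := imBound_tails hq hs.le
  have key := im_seriesE_div_lt hq hs t0 t1
  rw [hFun_re, e6_eq_seriesE (im_pos_of_le hy),
    sigmaSeries_one_eq (norm_nome_lt_one (im_pos_of_le hy))]
  -- `sin (2πx) ≤ 2πx` lets the summand `x` of `Re h` absorb `19320 Im q = 84 · 230 Im q`.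
  have hs2 : (nome z).im ≤ 1 / 230 * (2 * Real.pi * z.re) := by
    rw [nome_im, ← norm_nome]
    have := Real.pi_pos
    refine mul_le_mul hq (Real.sin_le (by positivity)) ?_ (by norm_num)
    exact Real.sin_nonneg_of_nonneg_of_le_pi (by positivity) (by nlinarith)
  rw [sub_pos, div_lt_iff₀ (by positivity)]
  linarith

lemma norm_e6_div_sub_le {z : ℂ} (hy : Real.sqrt 3 / 2 ≤ z.im) (h0 : 0 ≤ z.re)
    (h1 : z.re ≤ 1 / 2) :
    ‖e6 z / sigmaSeries 1 (nome z) - (1 / nome z - 570)‖ ≤ 170 := by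
  have hq := norm_nome_le hy
  obtain ⟨t0, t1, t2⟩ := imBound_tails hq (nome_im_nonneg h0 h1)
  rw [e6_eq_seriesE (im_pos_of_le hy),
    sigmaSeries_one_eq (norm_nome_lt_one (im_pos_of_le hy))]
  exact norm_seriesE_div_sub_le (nome_ne_zero z) hq t0.1 t1.1

lemma hFun_im_neg_of_re_eq_half {z : ℂ} (hy : Real.sqrt 3 / 2 ≤ z.im) (hx : z.re = 1 / 2) :
    (hFun z).im < 0 := by
  have h := norm_e6_div_sub_le hy (by rw [hx]; norm_num) hx.le
  obtain ⟨hu, -⟩ := le_exp_two_pi_mul hy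
  have hn : 1 / nome z = ((-Real.exp (2 * Real.pi * z.im) : ℝ) : ℂ) := by
    rw [nome_eq, hx, show 2 * Real.pi * (1 / 2) = Real.pi by ring, Real.cos_pi, Real.sin_pi,
      Real.exp_neg]
    push_cast
    simp
  have h2 := (abs_le.mp ((abs_re_le_norm _).trans h)).2
  rw [hn, sub_re, sub_re, ofReal_re] at h2
  have h570 : (570 : ℂ).re = 570 := by simp
  rw [h570] at h2
  have hpi := Real.pi_pos
  rw [hFun_im]
  have h5 : (148 : ℝ) ≤ Real.exp 5 := by
    have : Real.exp 5 = Real.exp 1 ^ 5 := by rw [← Real.exp_nat_mul]; norm_num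
    rw [this]
    calc (148 : ℝ) ≤ 2.7182818283 ^ 5 := by norm_num
      _ ≤ _ := by gcongr; exact Real.exp_one_gt_d9.le
  -- The tangent line of `exp` at `5` dominates `84 u - 400` from `u = 5.44` on.
  have h6 : 148 * (2 * Real.pi * z.im - 4) ≤ Real.exp (2 * Real.pi * z.im) := by
    have : Real.exp (2 * Real.pi * z.im) = Real.exp 5 * Real.exp (2 * Real.pi * z.im - 5) := by
      rw [← Real.exp_add]; ring_nf
    rw [this]
    have h7 := Real.add_one_le_exp (2 * Real.pi * z.im - 5)
    refine mul_le_mul h5 (by linarith) (by linarith) (Real.exp_pos _).le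
  have : (e6 z / sigmaSeries 1 (nome z)).re / (168 * Real.pi) < - z.im := by
    rw [div_lt_iff₀ (by positivity)]
    nlinarith
  linarith

lemma norm_hFun_ge {z : ℂ} (hy : Real.sqrt 3 / 2 ≤ z.im) (h0 : 0 ≤ z.re)
    (h1 : z.re ≤ 1 / 2) :
    (Real.exp (2 * Real.pi * z.im) - 740) / (168 * Real.pi) - (z.im + 1 / 2) ≤ ‖hFun z‖ := by
  have h := norm_e6_div_sub_le hy h0 h1
  have hpi := Real.pi_pos
  have hn : ‖1 / nome z‖ = Real.exp (2 * Real.pi * z.im) := by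
    rw [norm_div, norm_one, norm_nome, Real.exp_neg, one_div, inv_inv]
  have hz : ‖z‖ ≤ z.im + 1 / 2 := by
    have := norm_le_abs_re_add_abs_im z
    rw [abs_of_nonneg h0, abs_of_pos (im_pos_of_le hy)] at this
    linarith
  set Q := e6 z / sigmaSeries 1 (nome z) with hQ
  have hQ2 : Real.exp (2 * Real.pi * z.im) - 740 ≤ ‖Q‖ := by
    have e : 1 / nome z = Q - (Q - (1 / nome z - 570)) + 570 := by ring
    have h3 : ‖1 / nome z‖ ≤ ‖Q‖ + ‖Q - (1 / nome z - 570)‖ + ‖(570 : ℂ)‖ := by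
      conv_lhs => rw [e]
      exact (norm_add_le _ _).trans (add_le_add (norm_sub_le _ _) le_rfl)
    rw [hn] at h3
    have : ‖(570 : ℂ)‖ = 570 := by simp
    linarith
  have hQ3 : ‖I / (168 * Real.pi) * Q‖ = ‖Q‖ / (168 * Real.pi) := by
    rw [norm_mul, norm_div, norm_I, norm_mul, norm_real, Real.norm_of_nonneg hpi.le]
    simp; ring
  have h4 : ‖I / (168 * Real.pi) * Q‖ ≤ ‖hFun z‖ + ‖z‖ := by
    have : I / (168 * Real.pi) * Q = hFun z - z := by rw [hFun, hQ]; ring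
    rw [this]; exact norm_sub_le _ _
  rw [hQ3] at h4
  have : (Real.exp (2 * Real.pi * z.im) - 740) / (168 * Real.pi) ≤ ‖Q‖ / (168 * Real.pi) := by
    gcongr
  linarith

/-- On `Re z = 0`, at and above `i`, `E₆` is nonnegative, as its `q`-expansion decreases
in `q` from `1` to its value `0` at `i`. -/
lemma hFun_im_pos_of_re_eq_zero (hI : e6 I = 0) {z : ℂ} (hy : 1 ≤ z.im) (hx : z.re = 0) :
    0 < (hFun z).im := by
  have hS : ∀ (k : ℕ) (r : ℝ), sigmaSeries k (r : ℂ) =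
      ((∑' n : ℕ, (n : ℝ) ^ k * (ArithmeticFunction.sigma 5 n : ℝ) * r ^ n : ℝ) : ℂ) := by
    intro k r
    rw [sigmaSeries, ofReal_tsum]
    push_cast; rfl
  have hn : ∀ w : ℂ, w.re = 0 → nome w = (Real.exp (-(2 * Real.pi * w.im)) : ℝ) := by
    intro w hw
    rw [nome_eq, hw]; simp
  have hpi := Real.pi_pos
  have hr1 : Real.exp (-(2 * Real.pi * 1)) < 1 := by
    rw [Real.exp_lt_one_iff]; linarith
  have hle : Real.exp (-(2 * Real.pi * z.im)) ≤ Real.exp (-(2 * Real.pi * 1)) := by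
    apply Real.exp_le_exp.mpr; nlinarith
  have hs := fun k => summable_pow_mul_sigma k (Real.exp_pos (-(2 * Real.pi * z.im))).le
    (hle.trans_lt hr1)
  have hs1 := summable_pow_mul_sigma 0 (Real.exp_pos (-(2 * Real.pi * 1))).le hr1
  rw [e6, hn I I_re, hS, I_im] at hI
  rw [hFun_im, e6, hn z hx, hS, hS]
  have hmono := (hs 0).tsum_le_tsum (fun n => by gcongr) hs1
  set a := ∑' n : ℕ, (n : ℝ) ^ 0 * (ArithmeticFunction.sigma 5 n : ℝ) *
    Real.exp (-(2 * Real.pi * z.im)) ^ n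
  set b := ∑' n : ℕ, (n : ℝ) ^ 0 * (ArithmeticFunction.sigma 5 n : ℝ) *
    Real.exp (-(2 * Real.pi * 1)) ^ n
  have hb : 1 - 504 * b = 0 := by exact_mod_cast hI
  have hg : 0 ≤ ∑' n : ℕ, (n : ℝ) ^ 1 * (ArithmeticFunction.sigma 5 n : ℝ) *
    Real.exp (-(2 * Real.pi * z.im)) ^ n := tsum_nonneg fun n => by positivity
  set g := ∑' n : ℕ, (n : ℝ) ^ 1 * (ArithmeticFunction.sigma 5 n : ℝ) *
    Real.exp (-(2 * Real.pi * z.im)) ^ n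
  rw [show (1 - 504 * (a : ℂ)) / (g : ℂ) = (((1 - 504 * a) / g : ℝ) : ℂ) by push_cast; rfl,
    ofReal_re]
  have : 0 ≤ (1 - 504 * a) / g / (168 * Real.pi) := by
    have : 0 ≤ 1 - 504 * a := by linarith
    positivity
  linarith

/-! ### Modularity and reflection -/

section Modularity

open UpperHalfPlane hiding I
open scoped ModularForm

lemma E₆_eq_e6 (τ : ℍ) : ModularForm.E₆ τ = e6 (τ : ℂ) := by
  have h := EisensteinSeries.q_expansion_bernoulli (k := 6) (by norm_num) ⟨3, rfl⟩ τ
  have hb : (bernoulli 6 : ℚ) = 1 / 42 := by decide +kernel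
  rw [hb] at h
  refine h.trans ?_
  rw [e6, sigmaSeries]
  have : ∀ n : ℕ, (n : ℂ) ^ 0 * (ArithmeticFunction.sigma 5 n : ℂ) * nome (τ : ℂ) ^ n =
      (ArithmeticFunction.sigma 5 n : ℂ) * nome (τ : ℂ) ^ n := fun n => by simp
  simp_rw [this]
  have hs : Summable fun n : ℕ => (ArithmeticFunction.sigma 5 n : ℂ) * nome (τ : ℂ) ^ n := by
    have := summable_sigmaSeries 0 (norm_nome_lt_one (z := (τ : ℂ)) τ.im_pos)
    simpa using this
  rw [← tsum_zero_pnat_eq_tsum_nat hs]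
  norm_num [nome]

lemma e6_eventuallyEq (τ : ℍ) :
    (fun z : ℂ => ModularForm.E₆ (UpperHalfPlane.ofComplex z)) =ᶠ[nhds (τ : ℂ)] e6 := by
  filter_upwards [isOpen_upperHalfPlaneSet.mem_nhds τ.im_pos] with z hz
  rw [E₆_eq_e6, ofComplex_apply_of_im_pos hz]

lemma derivE6_eq (τ : ℍ) :
    derivE6 τ = -(1008 * Real.pi * I) * sigmaSeries 1 (nome (τ : ℂ)) := by
  rw [derivE6, (e6_eventuallyEq τ).deriv_eq, (hasDerivAt_e6 τ.im_pos).deriv]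

lemma derivE6_eq_zero_iff (τ : ℍ) : derivE6 τ = 0 ↔ sigmaSeries 1 (nome (τ : ℂ)) = 0 := by
  simp [derivE6_eq]

lemma derivE6_mul_hFun {τ : ℍ} (h : derivE6 τ ≠ 0) :
    derivE6 τ * hFun τ = τ * derivE6 τ + 6 * ModularForm.E₆ τ := by
  have h' := (derivE6_eq_zero_iff τ).not.mp h
  have hpi : (Real.pi : ℂ) ≠ 0 := ofReal_ne_zero.mpr Real.pi_ne_zero
  rw [E₆_eq_e6, derivE6_eq, hFun]
  field_simp
  ring_nf
  rw [I_sq]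
  ring

lemma E₆_mdifferentiable :
    MDifferentiable (modelWithCornersSelf ℂ ℂ) (modelWithCornersSelf ℂ ℂ)
      (ModularForm.E₆ : ℍ → ℂ) :=
  ModularFormClass.holo ModularForm.E₆

lemma E₆_slash (γ : SL(2, ℤ)) :
    (ModularForm.E₆ : ℍ → ℂ) ∣[(6 : ℤ)] γ = ModularForm.E₆ :=
  SlashInvariantFormClass.slash_action_eq ModularForm.E₆ _ ⟨γ, rfl⟩

/-- The transformation law of `E₆'`, obtained by differentiating that of `E₆`. -/
lemma derivE6_smul (γ : SL(2, ℤ)) (τ : ℍ) :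
    derivE6 (γ • τ) = denom γ τ ^ 7 *
      (denom γ τ * derivE6 τ + 6 * (γ 1 0 : ℂ) * ModularForm.E₆ τ) := by
  have h := congrFun (Derivative.normalizedDerivOfComplex_SL_slash (γ := γ) (k := 6)
    E₆_mdifferentiable) τ
  rw [E₆_slash] at h
  have hd := denom_ne_zero (γ : GL (Fin 2) ℝ) τ
  have hD : ∀ σ : ℍ, Derivative.normalizedDerivOfComplex (ModularForm.E₆ : ℍ → ℂ) σ =
      (2 * Real.pi * I)⁻¹ * derivE6 σ := fun σ => rfl
  rw [Pi.sub_apply, ModularForm.SL_slash_apply, hD, hD] at h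
  have hpi : (Real.pi : ℂ) ≠ 0 := ofReal_ne_zero.mpr Real.pi_ne_zero
  have hz : denom γ τ ^ (-(6 + 2) : ℤ) = (denom γ τ ^ 8)⁻¹ := by
    rw [zpow_neg]; norm_cast
  rw [hz] at h
  field_simp at h
  push_cast at h
  linear_combination (-1 : ℂ) * h

lemma derivE6_smul_eq_zero_iff (γ : SL(2, ℤ)) (τ : ℍ) :
    derivE6 (γ • τ) = 0 ↔
      ((γ 1 0 : ℂ) * τ + γ 1 1) * derivE6 τ + 6 * (γ 1 0 : ℂ) * ModularForm.E₆ τ = 0 := by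
  rw [derivE6_smul, mul_eq_zero, or_iff_right (pow_ne_zero _ (denom_ne_zero _ τ))]
  rfl

lemma nome_neg_conj (z : ℂ) : nome (-(starRingEnd ℂ) z) = (starRingEnd ℂ) (nome z) := by
  rw [nome, nome, ← exp_conj]; congr 1; simp [map_ofNat]

lemma nome_add_one (z : ℂ) : nome (1 + z) = nome z := by
  rw [nome, nome, show 2 * (Real.pi : ℂ) * I * (1 + z) =
    2 * Real.pi * I * z + 2 * Real.pi * I by ring, exp_periodic]

/-- The reflection in the line `Re τ = 1/2`. -/
def reflectHalf (τ : ℍ) : ℍ := ⟨1 - (starRingEnd ℂ) (τ : ℂ), by simpa using τ.im_pos⟩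

lemma nome_one_sub_conj (z : ℂ) : nome (1 - (starRingEnd ℂ) z) = (starRingEnd ℂ) (nome z) := by
  rw [sub_eq_add_neg, nome_add_one, nome_neg_conj]

lemma E₆_reflectHalf (τ : ℍ) :
    ModularForm.E₆ (reflectHalf τ) = (starRingEnd ℂ) (ModularForm.E₆ τ) := by
  rw [E₆_eq_e6, E₆_eq_e6, reflectHalf, e6, e6]
  simp only
  rw [nome_one_sub_conj, sigmaSeries_conj]; simp [map_ofNat]

lemma derivE6_reflectHalf (τ : ℍ) :
    derivE6 (reflectHalf τ) = -(starRingEnd ℂ) (derivE6 τ) := by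
  rw [derivE6_eq, derivE6_eq, reflectHalf]
  simp only
  rw [nome_one_sub_conj, sigmaSeries_conj]; simp [map_ofNat]

/-- `E₆(i) = 0`, because `E₆(i) = E₆(-1/i) = i⁶ E₆(i)`. -/
lemma e6_I : e6 I = 0 := by
  have h := congrFun (E₆_slash ModularGroup.S) UpperHalfPlane.I
  rw [ModularForm.SL_slash_apply] at h
  have hS : ModularGroup.S • UpperHalfPlane.I = UpperHalfPlane.I := by
    rw [UpperHalfPlane.modular_S_smul]; ext; simp
  have hd : denom ModularGroup.S UpperHalfPlane.I = I := by
    rw [ModularGroup.denom_S]; rfl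
  rw [hS, hd] at h
  have hz : (I : ℂ) ^ (-6 : ℤ) = -1 := by
    rw [zpow_neg]
    norm_cast
    rw [show (6 : ℕ) = 2 * 3 by norm_num, pow_mul, I_sq]; norm_num
  rw [hz] at h
  have h2 : ModularForm.E₆ UpperHalfPlane.I = 0 := by linear_combination (-1 / 2 : ℂ) * h
  rwa [E₆_eq_e6] at h2

/-- `h` maps the unit circle to itself: there `-1/τ = -τ̄`, so the factor `h(τ)` in
`E₆'(-1/τ) = τ⁷ E₆'(τ) h(τ)` has modulus one. -/
lemma norm_hFun_eq_one {τ : ℍ} (hτ : ‖(τ : ℂ)‖ = 1) (h : derivE6 τ ≠ 0) : ‖hFun τ‖ = 1 := by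
  have h1 := derivE6_smul ModularGroup.S τ
  have hd : denom ModularGroup.S τ = τ := ModularGroup.denom_S τ
  have e10 : (ModularGroup.S 1 0 : ℂ) = 1 := by simp [ModularGroup.S]
  rw [hd, e10, mul_one, ← derivE6_mul_hFun h] at h1
  have hinv : ((ModularGroup.S • τ : ℍ) : ℂ) = -(starRingEnd ℂ) (τ : ℂ) := by
    rw [UpperHalfPlane.modular_S_smul]
    simp only
    rw [inv_neg, inv_def, normSq_eq_norm_sq, hτ]; simp
  have h2 : ‖derivE6 (ModularGroup.S • τ)‖ = ‖derivE6 τ‖ := by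
    rw [derivE6_eq, derivE6_eq, hinv, nome_neg_conj, sigmaSeries_conj]; simp
  rw [h1, norm_mul, norm_pow, hτ, norm_mul] at h2
  have : 0 < ‖derivE6 τ‖ := norm_pos_iff.mpr h
  field_simp at h2
  simpa using h2

end Modularity

/-! ### Real values of `h` on the triangle -/

/-- The closed half `0 ≤ Re z ≤ 1/2`, `|z| ≥ 1` of the standard fundamental domain of `SL(2, ℤ)`, as
a subset of `ℂ`. The condition `Im z ≥ √3/2` follows from the others when `Im z > 0`; it makes the
set closed in `ℂ`. -/
def modularTriangle : Set ℂ :=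
  {z | 0 ≤ z.re ∧ z.re ≤ 1 / 2 ∧ 1 ≤ ‖z‖ ∧ Real.sqrt 3 / 2 ≤ z.im}

/-- The interior of `modularTriangle`. -/
def openModularTriangle : Set ℂ := {z | 0 < z.re ∧ z.re < 1 / 2 ∧ 1 < ‖z‖ ∧ 0 < z.im}

lemma sqrt_three_div_two_le {z : ℂ} (hy : 0 < z.im) (h0 : 0 ≤ z.re) (h1 : z.re ≤ 1 / 2)
    (hn : 1 ≤ ‖z‖) : Real.sqrt 3 / 2 ≤ z.im := by
  have h := one_le_pow₀ hn (n := 2)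
  rw [← normSq_eq_norm_sq, normSq_apply] at h
  have : Real.sqrt 3 ≤ 2 * z.im := Real.sqrt_le_iff.mpr ⟨by linarith, by nlinarith⟩
  linarith

lemma openModularTriangle_subset : openModularTriangle ⊆ modularTriangle := fun _ h =>
  ⟨h.1.le, h.2.1.le, h.2.2.1.le,
    sqrt_three_div_two_le h.2.2.2 h.1.le h.2.1.le h.2.2.1.le⟩

lemma openModularTriangle_subset_halfStrip : openModularTriangle ⊆ halfStrip := fun _ h =>
  ⟨h.1, h.2.1, (openModularTriangle_subset h).2.2.2⟩

lemma isOpen_openModularTriangle : IsOpen openModularTriangle :=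
  (isOpen_lt continuous_const continuous_re).inter
    ((isOpen_lt continuous_re continuous_const).inter
      ((isOpen_lt continuous_const continuous_norm).inter
        (isOpen_lt continuous_const continuous_im)))

lemma isClosed_modularTriangle : IsClosed modularTriangle :=
  (isClosed_le continuous_const continuous_re).inter
    ((isClosed_le continuous_re continuous_const).inter
      ((isClosed_le continuous_const continuous_norm).inter
        (isClosed_le continuous_const continuous_im)))

lemma continuousOn_hFun : ContinuousOn hFun modularTriangle := fun _ hz =>
  (continuousAt_hFun hz.2.2.2 hz.1 hz.2.1).continuousWithinAt

/-- `h` is proper on the triangle, since it grows like `1/q` at the cusp. -/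
lemma isClosed_hFun_image : IsClosed (hFun '' modularTriangle) := by
  refine isClosed_of_closure_subset fun w hw => ?_
  set C := ‖w‖ + 1 with hC
  have hC0 : 0 ≤ C := by positivity
  set K := modularTriangle ∩ {z | z.im ≤ 1000 * (C + 1)} with hK
  have hKc : IsCompact K := by
    refine Metric.isCompact_of_isClosed_isBounded
      (isClosed_modularTriangle.inter (isClosed_le continuous_im continuous_const)) ?_
    refine (Metric.isBounded_closedBall (x := (0 : ℂ)) (r := 1 + 1000 * (C + 1))).subset ?_
    intro z hz
    obtain ⟨⟨h0, h1, -, hy⟩, hz2⟩ := hz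
    have := norm_le_abs_re_add_abs_im z
    rw [abs_of_nonneg h0, abs_of_pos (im_pos_of_le hy)] at this
    have hz3 : z.im ≤ 1000 * (C + 1) := hz2
    rw [mem_closedBall_zero_iff]
    linarith
  have hclosed : IsClosed (hFun '' K) :=
    (hKc.image_of_continuousOn (continuousOn_hFun.mono Set.inter_subset_left)).isClosed
  have hsub : Metric.ball w 1 ∩ hFun '' modularTriangle ⊆ hFun '' K := by
    rintro _ ⟨hb, z, hz, rfl⟩
    refine ⟨z, ⟨hz, ?_⟩, rfl⟩
    have hn : ‖hFun z‖ ≤ C := by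
      have h1 := norm_sub_norm_le (hFun z) w
      have h2 : ‖hFun z - w‖ < 1 := by simpa [dist_eq_norm] using hb
      linarith
    have hg := norm_hFun_ge hz.2.2.2 hz.1 hz.2.1
    have hpi := Real.pi_pos
    have hpi3 := Real.pi_gt_three
    have hpi4 := Real.pi_lt_four
    have hy := im_pos_of_le hz.2.2.2
    have he := Real.quadratic_le_exp_of_nonneg (x := 2 * Real.pi * z.im) (by positivity)
    by_contra hlt
    have hlt' : 1000 * (C + 1) < z.im := not_le.mp hlt
    have h3 : Real.exp (2 * Real.pi * z.im) - 740 ≤ (C + (z.im + 1 / 2)) * (168 * Real.pi) := by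
      rw [← div_le_iff₀ (by positivity)]; linarith
    have h4 : (C + (z.im + 1 / 2)) * (168 * Real.pi) ≤ (C + (z.im + 1 / 2)) * 672 := by
      gcongr; linarith
    have h5 : 18 * z.im ^ 2 ≤ (2 * Real.pi * z.im) ^ 2 / 2 := by
      have : (3 : ℝ) ^ 2 ≤ Real.pi ^ 2 := by gcongr
      nlinarith [sq_nonneg z.im]
    have h6 : 0 ≤ 2 * Real.pi * z.im := by positivity
    nlinarith
  have hmem : w ∈ closure (Metric.ball w 1 ∩ hFun '' modularTriangle) :=
    Metric.isOpen_ball.inter_closure ⟨Metric.mem_ball_self one_pos, hw⟩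
  exact Set.image_mono Set.inter_subset_left (closure_minimal hsub hclosed hmem)

lemma isOpen_hFun_image : IsOpen (hFun '' openModularTriangle) := by
  rw [isOpen_iff_mem_nhds]
  rintro _ ⟨z, hz, rfl⟩
  have hder : ∀ w ∈ openModularTriangle, HasDerivAt hFun
      (7 + e6 w * sigmaSeries 2 (nome w) / sigmaSeries 1 (nome w) ^ 2 / 84) w := fun w hw =>
    hasDerivAt_hFun hw.2.2.2 (sigmaSeries_one_ne_zero (openModularTriangle_subset hw).2.2.2
      hw.1.le hw.2.1.le)
  have han : AnalyticAt ℂ hFun z :=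
    DifferentiableOn.analyticAt (s := openModularTriangle)
      (fun w hw => (hder w hw).differentiableAt.differentiableWithinAt)
      (isOpen_openModularTriangle.mem_nhds hz)
  have hne : deriv hFun z ≠ 0 := by
    rw [(hder z hz).deriv]
    intro h
    have := im_deriv_hFun_neg (openModularTriangle_subset_halfStrip hz)
    rw [h] at this
    simp at this
  rw [← han.hasStrictDerivAt.map_nhds_eq hne]
  exact Filter.image_mem_map (isOpen_openModularTriangle.mem_nhds hz)

/-- A point of the triangle is an interior point, or lies on one of the three sides, where `h`
is not real or has modulus one. -/
lemma modularTriangle_cases {z : ℂ} (hz : z ∈ modularTriangle) :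
    z ∈ openModularTriangle ∨ (z.re = 0 ∧ 0 < (hFun z).im) ∨ (z.re = 1 / 2 ∧ (hFun z).im < 0) ∨
      (z ∈ halfStrip ∧ ‖z‖ = 1 ∧ ‖hFun z‖ = 1) := by
  obtain ⟨h0, h1, hn, hy⟩ := hz
  have hy0 := im_pos_of_le hy
  rcases h0.eq_or_lt with h0 | h0
  · refine .inr (.inl ⟨h0.symm, hFun_im_pos_of_re_eq_zero e6_I ?_ h0.symm⟩)
    have := norm_le_abs_re_add_abs_im z
    rw [← h0, abs_zero, abs_of_pos hy0] at this
    linarith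
  rcases h1.eq_or_lt with h1 | h1
  · exact .inr (.inr (.inl ⟨h1, hFun_im_neg_of_re_eq_half hy h1⟩))
  rcases hn.eq_or_lt with hn | hn
  · refine .inr (.inr (.inr ⟨⟨h0, h1, hy⟩, hn.symm, ?_⟩))
    exact norm_hFun_eq_one (τ := ⟨z, hy0⟩) hn.symm
      ((derivE6_eq_zero_iff _).not.mpr (sigmaSeries_one_ne_zero hy h0.le h1.le))
  · exact .inl ⟨h0, h1, hn, hy0⟩

lemma hFun_re_pos_of_im_eq_zero {z : ℂ} (hz : z ∈ modularTriangle) (him : (hFun z).im = 0) :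
    0 < (hFun z).re := by
  rcases modularTriangle_cases hz with h | ⟨-, h⟩ | ⟨-, h⟩ | ⟨h, -⟩
  · exact hFun_re_pos (openModularTriangle_subset_halfStrip h)
  · linarith
  · linarith
  · exact hFun_re_pos h

/-- The segment `[0, 1)` avoids the image of the boundary, so it is either contained in the image
or disjoint from it; and `0` is not in the image. -/
lemma one_le_hFun_re {z : ℂ} (hz : z ∈ modularTriangle) (him : (hFun z).im = 0) :
    1 ≤ (hFun z).re := by
  by_contra! hlt
  have hpos := hFun_re_pos_of_im_eq_zero hz him
  set J : Set ℂ := ofReal '' Set.Ico (0 : ℝ) 1 with hJ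
  have hJc : IsPreconnected J :=
    isPreconnected_Ico.image _ continuous_ofReal.continuousOn
  have hcov : J ⊆ hFun '' openModularTriangle ∪ (hFun '' modularTriangle)ᶜ := by
    rintro _ ⟨r, hr, rfl⟩
    by_cases hA : (r : ℂ) ∈ hFun '' modularTriangle
    · obtain ⟨w, hw, hwr⟩ := hA
      rcases modularTriangle_cases hw with h | ⟨-, h⟩ | ⟨-, h⟩ | ⟨-, -, h⟩
      · exact .inl ⟨w, h, hwr⟩
      · rw [hwr, ofReal_im] at h; exact (lt_irrefl _ h).elim
      · rw [hwr, ofReal_im] at h; exact (lt_irrefl _ h).elim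
      · rw [hwr, norm_real, Real.norm_of_nonneg hr.1] at h
        exact (hr.2.ne h).elim
    · exact .inr hA
  have h0 : (J ∩ (hFun '' modularTriangle)ᶜ).Nonempty := by
    refine ⟨0, ⟨0, ⟨le_rfl, one_pos⟩, ofReal_zero⟩, ?_⟩
    rintro ⟨w, hw, hw0⟩
    have := hFun_re_pos_of_im_eq_zero hw (by rw [hw0, zero_im])
    rw [hw0, zero_re] at this
    exact lt_irrefl _ this
  have hdisj : Disjoint (hFun '' openModularTriangle) (hFun '' modularTriangle)ᶜ :=
    Set.disjoint_compl_right_iff_subset.mpr (Set.image_mono openModularTriangle_subset)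
  have hsub := hJc.subset_right_of_subset_union isOpen_hFun_image
    isClosed_hFun_image.isOpen_compl hdisj hcov h0
  refine hsub ⟨(hFun z).re, ⟨hpos.le, hlt⟩, ?_⟩ ⟨z, hz, rfl⟩
  apply Complex.ext <;> simp [him]

/-- Along a path `x ↦ x + i y(x)`, `0 ≤ x ≤ 1/2`, in the triangle that starts at `i`, the function
`h` takes a real value at an interior parameter, as `h(i) = i` and `Im h < 0` on `Re z = 1/2`. -/
lemma exists_hFun_im_eq_zero {y : ℝ → ℝ} (hy : Continuous y) (hy0 : y 0 = 1)
    (hmem : ∀ x ∈ Set.Icc (0 : ℝ) (1 / 2), (⟨x, y x⟩ : ℂ) ∈ modularTriangle) :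
    ∃ x ∈ Set.Ioo (0 : ℝ) (1 / 2), (hFun ⟨x, y x⟩).im = 0 := by
  have hc : ContinuousOn (fun x : ℝ => (hFun ⟨x, y x⟩).im) (Set.Icc 0 (1 / 2)) := by
    refine continuous_im.comp_continuousOn (continuousOn_hFun.comp ?_ hmem)
    have : (fun x : ℝ => (⟨x, y x⟩ : ℂ)) = fun x : ℝ => (x : ℂ) + y x * I := by
      ext x; rw [← mk_eq_add_mul_I]
    rw [this]
    fun_prop
  have hpos : 0 < (hFun ⟨0, y 0⟩).im := hFun_im_pos_of_re_eq_zero e6_I hy0.ge rfl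
  have hneg : (hFun ⟨1 / 2, y (1 / 2)⟩).im < 0 :=
    hFun_im_neg_of_re_eq_half (hmem _ ⟨by norm_num, le_rfl⟩).2.2.2 rfl
  exact intermediate_value_Ioo' (by norm_num) hc ⟨hneg, hpos⟩

/-- Along the unit circle, where `|h| = 1` and `Re h > 0`, a real value of `h` is `1`. -/
lemma exists_hFun_eq_one : ∃ z ∈ halfStrip, ‖z‖ = 1 ∧ hFun z = 1 := by
  have hn : ∀ x ∈ Set.Icc (0 : ℝ) (1 / 2), ‖(⟨x, Real.sqrt (1 - x ^ 2)⟩ : ℂ)‖ = 1 := by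
    intro x hx
    have : 0 ≤ 1 - x ^ 2 := by nlinarith [hx.1, hx.2]
    rw [norm_eq_sqrt_sq_add_sq]
    simp [Real.sq_sqrt this]
  have hmem : ∀ x ∈ Set.Icc (0 : ℝ) (1 / 2),
      (⟨x, Real.sqrt (1 - x ^ 2)⟩ : ℂ) ∈ modularTriangle := by
    intro x hx
    have : 0 < 1 - x ^ 2 := by nlinarith [hx.1, hx.2]
    exact ⟨hx.1, hx.2, (hn x hx).ge,
      sqrt_three_div_two_le (Real.sqrt_pos.mpr this) hx.1 hx.2 (hn x hx).ge⟩
  obtain ⟨x, hx, him⟩ := exists_hFun_im_eq_zero (y := fun x => Real.sqrt (1 - x ^ 2))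
    (by fun_prop) (by simp) hmem
  have hx' : x ∈ Set.Icc (0 : ℝ) (1 / 2) := ⟨hx.1.le, hx.2.le⟩
  refine ⟨_, ⟨hx.1, hx.2, (hmem x hx').2.2.2⟩, hn x hx', ?_⟩
  have hre := hFun_re_pos_of_im_eq_zero (hmem x hx') him
  have h1 : ‖hFun ⟨x, Real.sqrt (1 - x ^ 2)⟩‖ = 1 := by
    rcases modularTriangle_cases (hmem x hx') with h | ⟨h, -⟩ | ⟨h, -⟩ | ⟨-, -, h⟩
    · exact absurd (hn x hx') h.2.2.1.ne'
    · exact absurd h hx.1.ne'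
    · exact absurd h hx.2.ne
    · exact h
  have e : hFun ⟨x, Real.sqrt (1 - x ^ 2)⟩ =
      ((hFun ⟨x, Real.sqrt (1 - x ^ 2)⟩).re : ℂ) := by
    apply Complex.ext
    · simp
    · rw [him, ofReal_im]
  rw [e, norm_real, Real.norm_of_nonneg hre.le] at h1
  rw [e, h1, ofReal_one]

/-- Along `Im z = 1`, the real value of `h` is at least `1`, and it is not `1` by injectivity, since
`1` is attained on the unit circle. -/
lemma exists_hFun_eq_gt_one : ∃ z ∈ openModularTriangle, ∃ r : ℝ, 1 < r ∧ hFun z = r := by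
  have hmem : ∀ x ∈ Set.Icc (0 : ℝ) (1 / 2), (⟨x, 1⟩ : ℂ) ∈ modularTriangle := by
    intro x hx
    have hn : 1 ≤ ‖(⟨x, 1⟩ : ℂ)‖ := by simpa using abs_im_le_norm (⟨x, 1⟩ : ℂ)
    exact ⟨hx.1, hx.2, hn, sqrt_three_div_two_le one_pos hx.1 hx.2 hn⟩
  obtain ⟨x, hx, him⟩ := exists_hFun_im_eq_zero (y := fun _ => 1) continuous_const rfl hmem
  have hm := hmem x ⟨hx.1.le, hx.2.le⟩
  have e : hFun ⟨x, 1⟩ = ((hFun ⟨x, 1⟩).re : ℂ) := by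
    apply Complex.ext
    · simp
    · rw [him, ofReal_im]
  have hn : 1 < ‖(⟨x, 1⟩ : ℂ)‖ := by
    rw [norm_eq_sqrt_sq_add_sq]
    refine Real.lt_sqrt_of_sq_lt ?_
    nlinarith [hx.1]
  refine ⟨⟨x, 1⟩, ⟨hx.1, hx.2, hn, one_pos⟩, _, ?_, e⟩
  refine lt_of_le_of_ne (one_le_hFun_re hm him) fun h1 => ?_
  obtain ⟨w, hw, hwn, hw1⟩ := exists_hFun_eq_one
  rw [← h1, ofReal_one, ← hw1] at e
  have := injOn_hFun ⟨hx.1, hx.2, hm.2.2.2⟩ hw e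
  rw [this, hwn] at hn
  exact lt_irrefl _ hn

/-- The ray `(1, ∞)` avoids the image of the boundary and meets that of the interior, so it is
contained in the latter. -/
lemma exists_hFun_eq {r : ℝ} (hr : 1 < r) : ∃ z ∈ openModularTriangle, hFun z = r := by
  set J : Set ℂ := ofReal '' Set.Ioi (1 : ℝ) with hJ
  have hJc : IsPreconnected J :=
    isPreconnected_Ioi.image _ continuous_ofReal.continuousOn
  have hcov : J ⊆ hFun '' openModularTriangle ∪ (hFun '' modularTriangle)ᶜ := by
    rintro _ ⟨r, hr, rfl⟩
    by_cases hA : (r : ℂ) ∈ hFun '' modularTriangle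
    · obtain ⟨w, hw, hwr⟩ := hA
      have hr1 : (1 : ℝ) < r := hr
      rcases modularTriangle_cases hw with h | ⟨-, h⟩ | ⟨-, h⟩ | ⟨-, -, h⟩
      · exact .inl ⟨w, h, hwr⟩
      · rw [hwr, ofReal_im] at h; exact (lt_irrefl _ h).elim
      · rw [hwr, ofReal_im] at h; exact (lt_irrefl _ h).elim
      · rw [hwr, norm_real, Real.norm_of_nonneg (by linarith)] at h
        exact (hr1.ne' h).elim
    · exact .inr hA
  have h0 : (J ∩ hFun '' openModularTriangle).Nonempty := by
    obtain ⟨z, hz, s, hs, hzs⟩ := exists_hFun_eq_gt_one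
    exact ⟨s, ⟨s, hs, rfl⟩, z, hz, hzs⟩
  have hdisj : Disjoint (hFun '' openModularTriangle) (hFun '' modularTriangle)ᶜ :=
    Set.disjoint_compl_right_iff_subset.mpr (Set.image_mono openModularTriangle_subset)
  exact hJc.subset_left_of_subset_union isOpen_hFun_image
    isClosed_hFun_image.isOpen_compl hdisj hcov h0 ⟨r, hr, rfl⟩

/-- Points of the triangle with real image lie in the half-strip, where `h` is injective. -/
lemma eq_of_hFun_eq {z w : ℂ} (hz : z ∈ modularTriangle) (hw : w ∈ halfStrip)
    (hzw : hFun z = hFun w) (him : (hFun w).im = 0) : z = w := by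
  refine injOn_hFun ?_ hw hzw
  rcases modularTriangle_cases hz with h | ⟨-, h⟩ | ⟨-, h⟩ | ⟨h, -⟩
  · exact openModularTriangle_subset_halfStrip h
  · rw [hzw] at h; linarith
  · rw [hzw] at h; linarith
  · exact h

/-! ### Critical points in the translates of `F₀` -/

section Geometry

/-- The form `(cτ + d) E₆'(τ) + 6c E₆(τ)`, whose zeros are the `τ` with `E₆'(γτ) = 0` for a matrix
`γ` with bottom row `(c, d)`. -/
noncomputable def criticalForm (c d : ℤ) (τ : ℍ) : ℂ :=
  ((c : ℂ) * τ + d) * derivE6 τ + 6 * (c : ℂ) * ModularForm.E₆ τ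

lemma derivE6_smul_eq_zero_iff_criticalForm (γ : SL(2, ℤ)) (τ : ℍ) :
    derivE6 (γ • τ) = 0 ↔ criticalForm (γ 1 0) (γ 1 1) τ = 0 :=
  derivE6_smul_eq_zero_iff γ τ

lemma derivE6_ne_zero {τ : ℍ} (hτ : (τ : ℂ) ∈ modularTriangle) : derivE6 τ ≠ 0 :=
  (derivE6_eq_zero_iff τ).not.mpr (sigmaSeries_one_ne_zero hτ.2.2.2 hτ.1 hτ.2.1)

lemma criticalForm_eq_zero_iff {τ : ℍ} (hτ : (τ : ℂ) ∈ modularTriangle) (c d : ℤ) :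
    criticalForm c d τ = 0 ↔ (c : ℂ) * hFun τ + d = 0 := by
  have h := derivE6_ne_zero hτ
  have h2 := derivE6_mul_hFun h
  have : criticalForm c d τ = derivE6 τ * ((c : ℂ) * hFun τ + d) := by
    rw [criticalForm]; linear_combination (-(c : ℂ)) * h2
  rw [this, mul_eq_zero, or_iff_right h]

lemma mul_add_eq_zero_iff {c d : ℤ} (hc : c ≠ 0) (w : ℂ) :
    (c : ℂ) * w + d = 0 ↔ w = ((-(d : ℝ) / c : ℝ) : ℂ) := by
  have hc' : (c : ℂ) ≠ 0 := by exact_mod_cast hc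
  push_cast
  rw [eq_div_iff hc']
  constructor <;> intro h <;> linear_combination h

/-- In the triangle `h` takes no real value below `1`; for `-d/c` this reads `c (c + d) ≤ 0`. -/
lemma mul_add_nonpos_of_criticalForm_eq_zero {τ : ℍ} (hτ : (τ : ℂ) ∈ modularTriangle) {c d : ℤ}
    (hcd : c ≠ 0 ∨ d ≠ 0) (h : criticalForm c d τ = 0) : c ≠ 0 ∧ c * (c + d) ≤ 0 := by
  rw [criticalForm_eq_zero_iff hτ] at h
  have hc : c ≠ 0 := by
    rintro rfl
    simp at h hcd
    exact hcd h
  refine ⟨hc, ?_⟩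
  rw [mul_add_eq_zero_iff hc] at h
  have h1 := one_le_hFun_re hτ (by rw [h, ofReal_im])
  rw [h, ofReal_re] at h1
  have hc2 : (0 : ℝ) < (c : ℝ) ^ 2 := by positivity
  have e : (-(d : ℝ) / c) * (c : ℝ) ^ 2 = -(d * c) := by field_simp
  have : (c : ℝ) * (c + d) ≤ 0 := by nlinarith
  exact_mod_cast this

/-- A value `-d/c > 1` is taken by `h` exactly once in the triangle, in its interior. -/
lemma exists_criticalForm_eq_zero_iff {c d : ℤ} (h : c * (c + d) < 0) :
    ∃ τ₁ : ℍ, (τ₁ : ℂ) ∈ openModularTriangle ∧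
      ∀ τ : ℍ, (τ : ℂ) ∈ modularTriangle → (criticalForm c d τ = 0 ↔ τ = τ₁) := by
  have hc : c ≠ 0 := by rintro rfl; simp at h
  have hr : 1 < -(d : ℝ) / c := by
    have hc2 : (0 : ℝ) < (c : ℝ) ^ 2 := by positivity
    have e : (-(d : ℝ) / c) * (c : ℝ) ^ 2 = -(d * c) := by field_simp
    have : (c : ℝ) * (c + d) < 0 := by exact_mod_cast h
    by_contra! hle
    nlinarith
  obtain ⟨z, hz, hzr⟩ := exists_hFun_eq hr
  refine ⟨⟨z, hz.2.2.2⟩, hz, fun τ hτ => ?_⟩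
  rw [criticalForm_eq_zero_iff hτ, mul_add_eq_zero_iff hc, ← hzr]
  constructor
  · intro h
    exact UpperHalfPlane.ext (eq_of_hFun_eq hτ (openModularTriangle_subset_halfStrip hz) h
      (by rw [hzr, ofReal_im]))
  · rintro rfl; rfl

/-- The value `-d/c = 1` is taken by `h` exactly once in the triangle, on the unit circle. -/
lemma exists_criticalForm_neg_eq_zero_iff :
    ∃ τ₁ : ℍ, (τ₁ : ℂ) ∈ halfStrip ∧ ‖(τ₁ : ℂ)‖ = 1 ∧
      ∀ τ : ℍ, (τ : ℂ) ∈ modularTriangle → ∀ d : ℤ, d ≠ 0 →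
        (criticalForm (-d) d τ = 0 ↔ τ = τ₁) := by
  obtain ⟨z, hz, hzn, hz1⟩ := exists_hFun_eq_one
  refine ⟨⟨z, im_pos_of_le hz.2.2⟩, hz, hzn, fun τ hτ d hd => ?_⟩
  have hd' : (d : ℝ) ≠ 0 := by exact_mod_cast hd
  rw [criticalForm_eq_zero_iff hτ, mul_add_eq_zero_iff (neg_ne_zero.mpr hd)]
  have : -(d : ℝ) / ((-d : ℤ) : ℝ) = 1 := by push_cast; field_simp
  rw [this, ofReal_one, ← hz1]
  constructor
  · intro h
    exact UpperHalfPlane.ext (eq_of_hFun_eq hτ hz h (by rw [hz1, one_im]))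
  · rintro rfl; rfl

lemma reflectHalf_re (τ : ℍ) : (reflectHalf τ).re = 1 - τ.re := by
  change (1 - (starRingEnd ℂ) (τ : ℂ)).re = _
  simp

lemma reflectHalf_im (τ : ℍ) : (reflectHalf τ).im = τ.im := by
  change (1 - (starRingEnd ℂ) (τ : ℂ)).im = _
  simp

lemma reflectHalf_reflectHalf (τ : ℍ) : reflectHalf (reflectHalf τ) = τ := by
  apply UpperHalfPlane.ext_re_im
  · rw [reflectHalf_re, reflectHalf_re]; ring
  · rw [reflectHalf_im, reflectHalf_im]

lemma criticalForm_reflectHalf (c d : ℤ) (τ : ℍ) :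
    criticalForm c (-c - d) (reflectHalf τ) = (starRingEnd ℂ) (criticalForm c d τ) := by
  rw [criticalForm, criticalForm, derivE6_reflectHalf, E₆_reflectHalf]
  have : ((reflectHalf τ : ℍ) : ℂ) = 1 - (starRingEnd ℂ) (τ : ℂ) := rfl
  rw [this]
  simp only [map_add, map_mul, map_intCast, map_ofNat]
  push_cast
  ring

lemma criticalForm_reflectHalf_eq_zero_iff (c d : ℤ) (τ : ℍ) :
    criticalForm c (-c - d) (reflectHalf τ) = 0 ↔ criticalForm c d τ = 0 := by
  rw [criticalForm_reflectHalf, map_eq_zero]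

/-- The part `0 ≤ Re τ ≤ 1`, `|τ| ≥ 1`, `|τ - 1| ≥ 1` of `F₀`, written in real coordinates. -/
def upperPart : Set ℍ :=
  {τ | 0 ≤ τ.re ∧ τ.re ≤ 1 ∧ 1 ≤ τ.re ^ 2 + τ.im ^ 2 ∧ 1 ≤ (1 - τ.re) ^ 2 + τ.im ^ 2}

lemma norm_sq_coe (τ : ℍ) : ‖(τ : ℂ)‖ ^ 2 = τ.re ^ 2 + τ.im ^ 2 := by
  rw [← normSq_eq_norm_sq, normSq_apply]
  change τ.re * τ.re + τ.im * τ.im = _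
  ring

lemma one_le_norm_coe_iff (τ : ℍ) : 1 ≤ ‖(τ : ℂ)‖ ↔ 1 ≤ τ.re ^ 2 + τ.im ^ 2 := by
  rw [← norm_sq_coe, one_le_sq_iff₀ (norm_nonneg _)]

lemma one_lt_norm_coe_iff (τ : ℍ) : 1 < ‖(τ : ℂ)‖ ↔ 1 < τ.re ^ 2 + τ.im ^ 2 := by
  rw [← norm_sq_coe, one_lt_sq_iff₀ (norm_nonneg _)]

lemma coe_mem_modularTriangle {τ : ℍ} (h : τ ∈ upperPart) (h2 : τ.re ≤ 1 / 2) :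
    (τ : ℂ) ∈ modularTriangle := by
  have hn := (one_le_norm_coe_iff τ).mpr h.2.2.1
  exact ⟨h.1, h2, hn, sqrt_three_div_two_le τ.im_pos h.1 h2 hn⟩

lemma reflectHalf_mem_upperPart {τ : ℍ} (h : τ ∈ upperPart) : reflectHalf τ ∈ upperPart := by
  obtain ⟨h0, h1, h2, h3⟩ := h
  refine ⟨?_, ?_, ?_, ?_⟩ <;> rw [reflectHalf_re] <;> try rw [reflectHalf_im]
  · linarith
  · linarith
  · exact h3
  · rw [sub_sub_cancel]; exact h2

/-- A zero of a critical form in the upper part lies in the triangle, and then `-d/c ≥ 1`, or its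
reflection in `Re τ = 1/2` does, and then `-d/c ≤ 0`. -/
lemma criticalForm_eq_zero_cases {τ : ℍ} (hτ : τ ∈ upperPart) {c d : ℤ} (hcd : c ≠ 0 ∨ d ≠ 0)
    (h : criticalForm c d τ = 0) :
    ((τ : ℂ) ∈ modularTriangle ∧ c ≠ 0 ∧ c * (c + d) ≤ 0) ∨
      (((reflectHalf τ : ℍ) : ℂ) ∈ modularTriangle ∧ c ≠ 0 ∧ 0 ≤ c * d ∧
        criticalForm c (-c - d) (reflectHalf τ) = 0) := by
  rcases le_total τ.re (1 / 2) with h2 | h2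
  · have hm := coe_mem_modularTriangle hτ h2
    exact .inl ⟨hm, mul_add_nonpos_of_criticalForm_eq_zero hm hcd h⟩
  · have hm := coe_mem_modularTriangle (reflectHalf_mem_upperPart hτ)
      (by rw [reflectHalf_re]; linarith)
    have h' := (criticalForm_reflectHalf_eq_zero_iff c d τ).mpr h
    obtain ⟨hc, hle⟩ := mul_add_nonpos_of_criticalForm_eq_zero hm (by omega) h'
    refine .inr ⟨hm, hc, ?_, h'⟩
    have : c * (c + (-c - d)) = -(c * d) := by ring
    omega

/-- The matrix of `τ ↦ 1 / (1 - τ)`, the triRot of order three of `F₀`. -/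
def triRot : SL(2, ℤ) := ⟨!![0, 1; -1, 1], by simp [Matrix.det_fin_two]⟩

lemma coe_triRot_smul (τ : ℍ) : ((triRot • τ : ℍ) : ℂ) = 1 / (1 - τ) := by
  rw [UpperHalfPlane.coe_specialLinearGroup_apply]
  simp [triRot]
  ring

lemma one_sub_sq_add_pos (τ : ℍ) : 0 < (1 - τ.re) ^ 2 + τ.im ^ 2 := by
  have := τ.im_pos
  positivity

lemma normSq_one_sub (τ : ℍ) : normSq (1 - (τ : ℂ)) = (1 - τ.re) ^ 2 + τ.im ^ 2 := by
  rw [normSq_apply]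
  simp
  ring

lemma triRot_smul_re (τ : ℍ) :
    (triRot • τ).re = (1 - τ.re) / ((1 - τ.re) ^ 2 + τ.im ^ 2) := by
  change ((triRot • τ : ℍ) : ℂ).re = _
  rw [coe_triRot_smul, one_div, inv_re, normSq_one_sub]
  simp

lemma triRot_smul_im (τ : ℍ) :
    (triRot • τ).im = τ.im / ((1 - τ.re) ^ 2 + τ.im ^ 2) := by
  change ((triRot • τ : ℍ) : ℂ).im = _
  rw [coe_triRot_smul, one_div, inv_im, normSq_one_sub]
  simp

lemma triRot_sq_add (τ : ℍ) : (triRot • τ).re ^ 2 + (triRot • τ).im ^ 2 =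
    1 / ((1 - τ.re) ^ 2 + τ.im ^ 2) := by
  have := one_sub_sq_add_pos τ
  rw [triRot_smul_re, triRot_smul_im]
  field_simp

lemma triRot_one_sub_sq_add (τ : ℍ) : (1 - (triRot • τ).re) ^ 2 + (triRot • τ).im ^ 2 =
    (τ.re ^ 2 + τ.im ^ 2) / ((1 - τ.re) ^ 2 + τ.im ^ 2) := by
  have := one_sub_sq_add_pos τ
  rw [triRot_smul_re, triRot_smul_im]
  field_simp
  ring

lemma triRot_smul_smul_smul (τ : ℍ) : triRot • triRot • triRot • τ = τ := by
  have h : triRot * (triRot * triRot) = -1 := by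
    decide
  rw [smul_smul, smul_smul, mul_assoc, h, ModularGroup.SL_neg_smul, one_smul]

lemma mem_basicDomain_iff (τ : ℍ) :
    τ ∈ basicDomain ↔ 0 ≤ τ.re ∧ τ.re ≤ 1 ∧ τ.re ≤ τ.re ^ 2 + τ.im ^ 2 := by
  have h : ‖(τ : ℂ) - 1 / 2‖ ^ 2 = τ.re ^ 2 + τ.im ^ 2 - τ.re + 1 / 4 := by
    rw [← normSq_eq_norm_sq, normSq_apply]
    have h1 : ((τ : ℂ) - 1 / 2).re = τ.re - 1 / 2 := by simp
    have h2 : ((τ : ℂ) - 1 / 2).im = τ.im := by simp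
    rw [h1, h2]; ring
  have h2 : 1 / 2 ≤ ‖(τ : ℂ) - 1 / 2‖ ↔ τ.re ≤ τ.re ^ 2 + τ.im ^ 2 := by
    rw [← sq_le_sq₀ (by norm_num) (norm_nonneg _), h]
    constructor <;> intro h <;> linarith
  rw [← h2]; rfl

/-- The open subset of `F₀` given by strict inequalities, in real coordinates. -/
def openBasicDomain : Set ℍ :=
  {τ | 0 < τ.re ∧ τ.re < 1 ∧ τ.re < τ.re ^ 2 + τ.im ^ 2}

lemma openBasicDomain_subset : openBasicDomain ⊆ basicDomain := fun τ h =>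
  (mem_basicDomain_iff τ).mpr ⟨h.1.le, h.2.1.le, h.2.2.le⟩

lemma isOpen_openBasicDomain : IsOpen openBasicDomain := by
  have hre := UpperHalfPlane.continuous_re
  have him := UpperHalfPlane.continuous_im
  exact (isOpen_lt continuous_const hre).inter ((isOpen_lt hre continuous_const).inter
    (isOpen_lt hre ((hre.pow 2).add (him.pow 2))))

lemma triRot_smul_mem_basicDomain {τ : ℍ} (h : τ ∈ basicDomain) :
    triRot • τ ∈ basicDomain := by
  rw [mem_basicDomain_iff] at h ⊢
  have hn := one_sub_sq_add_pos τ
  rw [triRot_sq_add, triRot_smul_re, div_le_one hn]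
  refine ⟨div_nonneg (by linarith) hn.le, by nlinarith, ?_⟩
  gcongr
  linarith

lemma triRot_smul_mem_openBasicDomain {τ : ℍ} (h : τ ∈ openBasicDomain) :
    triRot • τ ∈ openBasicDomain := by
  obtain ⟨h0, h1, h2⟩ := h
  have hn := one_sub_sq_add_pos τ
  change 0 < _ ∧ _ < 1 ∧ _ < _
  rw [triRot_sq_add, triRot_smul_re, div_lt_one hn]
  refine ⟨div_pos (by linarith) hn, by nlinarith, ?_⟩
  gcongr
  linarith

lemma triRot_image_basicDomain : (fun τ : ℍ => triRot • τ) '' basicDomain = basicDomain := by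
  refine Set.Subset.antisymm ?_ fun τ hτ => ?_
  · rintro _ ⟨τ, hτ, rfl⟩
    exact triRot_smul_mem_basicDomain hτ
  · exact ⟨triRot • triRot • τ,
      triRot_smul_mem_basicDomain (triRot_smul_mem_basicDomain hτ),
      triRot_smul_smul_smul τ⟩

lemma translatedDomain_mul_triRot (γ : SL(2, ℤ)) :
    translatedDomain (γ * triRot) = translatedDomain γ := by
  rw [translatedDomain, translatedDomain]
  conv_rhs => rw [← triRot_image_basicDomain, Set.image_image]
  simp only [mul_smul]

/-- `F₀` is covered by the rotated copies of its upper part; which one contains `τ` depends on the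
smallest of `1`, `|τ|` and `|1 - τ|`. -/
lemma exists_mem_upperPart {τ : ℍ} (h : τ ∈ basicDomain) : ∃ σ ∈ upperPart,
    τ = σ ∨ τ = triRot • σ ∨ τ = triRot • triRot • σ := by
  have hr1 := triRot_smul_mem_basicDomain h
  have hr2 := triRot_smul_mem_basicDomain hr1
  rw [mem_basicDomain_iff] at h hr1 hr2
  have hn := one_sub_sq_add_pos τ
  have hp : 0 < τ.re ^ 2 + τ.im ^ 2 := by have := τ.im_pos; positivity
  have hn1 := one_sub_sq_add_pos (triRot • τ)
  by_cases ha : 1 ≤ τ.re ^ 2 + τ.im ^ 2 ∧ 1 ≤ (1 - τ.re) ^ 2 + τ.im ^ 2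
  · exact ⟨τ, ⟨h.1, h.2.1, ha.1, ha.2⟩, .inl rfl⟩
  by_cases hb : (1 - τ.re) ^ 2 + τ.im ^ 2 ≤ 1 ∧
      (1 - τ.re) ^ 2 + τ.im ^ 2 ≤ τ.re ^ 2 + τ.im ^ 2
  · refine ⟨triRot • τ, ⟨hr1.1, hr1.2.1, ?_, ?_⟩, .inr (.inr ?_)⟩
    · rw [triRot_sq_add, le_div_iff₀ hn]; linarith
    · rw [triRot_one_sub_sq_add, le_div_iff₀ hn]; linarith
    · rw [triRot_smul_smul_smul]
  · refine ⟨triRot • triRot • τ, ⟨hr2.1, hr2.2.1, ?_, ?_⟩, .inr (.inl ?_)⟩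
    · rw [triRot_sq_add, le_div_iff₀ hn1, triRot_one_sub_sq_add, one_mul, div_le_one hn]
      by_contra! hlt
      exact hb ⟨by by_contra! h1; exact ha ⟨by linarith, h1.le⟩, hlt.le⟩
    · rw [triRot_one_sub_sq_add, triRot_one_sub_sq_add, triRot_sq_add,
        div_div_div_cancel_right₀ hn.ne', le_div_iff₀ hp]
      by_contra! hlt
      rcases le_or_gt ((1 - τ.re) ^ 2 + τ.im ^ 2) 1 with h1 | h1
      · exact hb ⟨h1, by linarith⟩
      · exact ha ⟨by linarith, h1.le⟩
    · rw [triRot_smul_smul_smul]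

lemma mul_triRot_row (γ : SL(2, ℤ)) :
    (γ * triRot) 1 0 = -γ 1 1 ∧ (γ * triRot) 1 1 = γ 1 0 + γ 1 1 := by
  constructor <;> rw [Matrix.SpecialLinearGroup.coe_mul] <;>
    simp [triRot, Matrix.mul_apply, Fin.sum_univ_two]

lemma derivE6_smul_triRot_iff (γ : SL(2, ℤ)) (τ : ℍ) :
    derivE6 (γ • triRot • τ) = 0 ↔ criticalForm (-γ 1 1) (γ 1 0 + γ 1 1) τ = 0 := by
  rw [← mul_smul, derivE6_smul_eq_zero_iff_criticalForm, (mul_triRot_row γ).1,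
    (mul_triRot_row γ).2]

lemma derivE6_smul_triRot_triRot_iff (γ : SL(2, ℤ)) (τ : ℍ) :
    derivE6 (γ • triRot • triRot • τ) = 0 ↔
      criticalForm (-(γ 1 0 + γ 1 1)) (γ 1 0) τ = 0 := by
  rw [← mul_smul, derivE6_smul_triRot_iff, (mul_triRot_row γ).1, (mul_triRot_row γ).2]
  ring_nf

lemma image_openBasicDomain_subset_interior (γ : SL(2, ℤ)) :
    (fun τ : ℍ => γ • τ) '' openBasicDomain ⊆ interior (translatedDomain γ) := by
  have ho : IsOpenMap (fun τ : ℍ => γ • τ) :=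
    (Homeomorph.smul (γ : GL (Fin 2) ℝ) : ℍ ≃ₜ ℍ).isOpenMap
  exact interior_maximal (Set.image_mono openBasicDomain_subset) (ho _ isOpen_openBasicDomain)

lemma mem_openBasicDomain_of_mem {τ : ℍ} (h : (τ : ℂ) ∈ openModularTriangle) :
    τ ∈ openBasicDomain := by
  obtain ⟨h0, h1, h2, -⟩ := h
  have h0' : 0 < τ.re := h0
  have h1' : τ.re < 1 / 2 := h1
  rw [one_lt_norm_coe_iff] at h2
  exact ⟨h0, by linarith, by linarith⟩

/-- If `-d/c > 1`, then the critical points in `F₀` of `E₆ ∘ γ` are an interior point of the upper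
part and an interior point of its image under the square of `triRot`. -/
lemma criticalPoints_of_mul_add_neg {γ : SL(2, ℤ)} (h : γ 1 0 * (γ 1 0 + γ 1 1) < 0) :
    (criticalPointsIn (translatedDomain γ)).ncard = 2 ∧
      criticalPointsIn (translatedDomain γ) ⊆ interior (translatedDomain γ) := by
  set c := γ 1 0
  set d := γ 1 1
  have hc : c ≠ 0 := by rintro h0; rw [h0] at h; simp at h
  have hs : c + d ≠ 0 := by intro h0; rw [h0] at h; simp at h
  have hcd : c * d < 0 := by nlinarith [sq_nonneg c]
  have hsd : 0 < (c + d) * d := by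
    by_contra! hle
    nlinarith [mul_pos_of_neg_of_neg h hcd, mul_nonneg (sq_nonneg c) (neg_nonneg.mpr hle),
      sq_nonneg c]
  obtain ⟨τ₁, h₁, hτ₁⟩ := exists_criticalForm_eq_zero_iff h
  have h' : -(c + d) * (-(c + d) + (- -(c + d) - c)) < 0 := by
    have : -(c + d) * (-(c + d) + (- -(c + d) - c)) = c * (c + d) := by ring
    rw [this]; exact h
  obtain ⟨ρ, h₂, hρ⟩ := exists_criticalForm_eq_zero_iff h'
  set τ₂ : ℍ := triRot • triRot • reflectHalf ρ with hτ₂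
  have hρσ : reflectHalf ρ ∈ openBasicDomain := by
    obtain ⟨a0, a1, a2, -⟩ := h₂
    have a0' : 0 < ρ.re := a0
    have a1' : ρ.re < 1 / 2 := a1
    rw [one_lt_norm_coe_iff] at a2
    refine ⟨?_, ?_, ?_⟩ <;> rw [reflectHalf_re] <;> try rw [reflectHalf_im]
    · linarith
    · linarith
    · linarith
  have hO₁ := mem_openBasicDomain_of_mem h₁
  have hO₂ : τ₂ ∈ openBasicDomain :=
    triRot_smul_mem_openBasicDomain (triRot_smul_mem_openBasicDomain hρσ)
  have hne : τ₁ ≠ τ₂ := by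
    intro he
    have e1 : (1 - τ₂.re) ^ 2 + τ₂.im ^ 2 < 1 := by
      have hn := one_sub_sq_add_pos (reflectHalf ρ)
      have a2 := h₂.2.2.1
      rw [one_lt_norm_coe_iff] at a2
      have a1 : ρ.re < 1 / 2 := h₂.2.1
      rw [hτ₂, triRot_one_sub_sq_add, triRot_sq_add, triRot_one_sub_sq_add,
        div_div_div_cancel_right₀ hn.ne', reflectHalf_re, reflectHalf_im, div_lt_one]
      · nlinarith
      · nlinarith
    rw [← he] at e1
    have a2 := h₁.2.2.1
    rw [one_lt_norm_coe_iff] at a2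
    have a1 : τ₁.re < 1 / 2 := h₁.2.1
    nlinarith
  have hcrit : ∀ τ ∈ basicDomain, (derivE6 (γ • τ) = 0 ↔ τ = τ₁ ∨ τ = τ₂) := by
    intro τ hτ
    constructor
    · intro hz
      obtain ⟨σ, hσ, rfl | rfl | rfl⟩ := exists_mem_upperPart hτ
      · rw [derivE6_smul_eq_zero_iff_criticalForm] at hz
        rcases criticalForm_eq_zero_cases hσ (.inl hc) hz with ⟨hm, -⟩ | ⟨-, -, hle, -⟩
        · exact .inl ((hτ₁ τ hm).mp hz)
        · exact absurd hcd hle.not_gt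
      · rw [derivE6_smul_triRot_iff] at hz
        rcases criticalForm_eq_zero_cases hσ (.inr hs) hz with ⟨-, -, hle⟩ | ⟨-, -, hle, -⟩
        · nlinarith
        · nlinarith
      · rw [derivE6_smul_triRot_triRot_iff] at hz
        rcases criticalForm_eq_zero_cases hσ (.inr hc) hz with ⟨-, -, hle⟩ | ⟨hm, -, -, hz'⟩
        · nlinarith
        · right
          rw [hτ₂, ← (hρ _ hm).mp hz', reflectHalf_reflectHalf]
    · rintro (rfl | rfl)
      · rw [derivE6_smul_eq_zero_iff_criticalForm]
        exact (hτ₁ τ (openModularTriangle_subset h₁)).mpr rfl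
      · rw [hτ₂, derivE6_smul_triRot_triRot_iff, ← criticalForm_reflectHalf_eq_zero_iff,
          reflectHalf_reflectHalf]
        exact (hρ ρ (openModularTriangle_subset h₂)).mpr rfl
  have hset : criticalPointsIn (translatedDomain γ) = {γ • τ₁, γ • τ₂} := by
    ext τ
    constructor
    · rintro ⟨⟨σ, hσ, rfl⟩, hz⟩
      rcases (hcrit σ hσ).mp hz with rfl | rfl
      · exact .inl rfl
      · exact .inr rfl
    · rintro (rfl | rfl)
      · exact ⟨⟨τ₁, openBasicDomain_subset hO₁, rfl⟩,
          (hcrit _ (openBasicDomain_subset hO₁)).mpr (.inl rfl)⟩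
      · exact ⟨⟨τ₂, openBasicDomain_subset hO₂, rfl⟩,
          (hcrit _ (openBasicDomain_subset hO₂)).mpr (.inr rfl)⟩
  rw [hset]
  refine ⟨Set.ncard_pair fun he => hne (MulAction.injective γ he), ?_⟩
  rintro _ (rfl | rfl)
  · exact image_openBasicDomain_subset_interior γ ⟨τ₁, hO₁, rfl⟩
  · exact image_openBasicDomain_subset_interior γ ⟨τ₂, hO₂, rfl⟩

/-- Two interior critical points whenever `-d/c` is none of `0`, `1`, `∞`. -/
lemma criticalPoints_of_ne_zero {γ : SL(2, ℤ)} (hc : γ 1 0 ≠ 0) (hd : γ 1 1 ≠ 0)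
    (hs : γ 1 0 + γ 1 1 ≠ 0) :
    (criticalPointsIn (translatedDomain γ)).ncard = 2 ∧
      criticalPointsIn (translatedDomain γ) ⊆ interior (translatedDomain γ) := by
  -- Right multiplication by `triRot` permutes the intervals `r > 1`, `r < 0`, `0 < r < 1` of
  -- values of `r = -d/c` cyclically.
  rcases lt_trichotomy (γ 1 0 * (γ 1 0 + γ 1 1)) 0 with h | h | h
  · exact criticalPoints_of_mul_add_neg h
  · exact absurd h (mul_ne_zero hc hs)
  · obtain ⟨r0, r1⟩ := mul_triRot_row γ
    obtain ⟨s0, s1⟩ := mul_triRot_row (γ * triRot)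
    rcases lt_trichotomy (γ 1 0 * γ 1 1) 0 with h2 | h2 | h2
    · rw [← translatedDomain_mul_triRot γ, ← translatedDomain_mul_triRot (γ * triRot)]
      apply criticalPoints_of_mul_add_neg
      rw [s0, s1, r0, r1]
      by_contra! hle
      have h3 : 0 ≤ (γ 1 0 + γ 1 1) * γ 1 1 := by nlinarith
      nlinarith [mul_neg_of_pos_of_neg h h2, mul_nonneg (sq_nonneg (γ 1 0)) h3]
    · exact absurd h2 (mul_ne_zero hc hd)
    · rw [← translatedDomain_mul_triRot γ]
      apply criticalPoints_of_mul_add_neg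
      rw [r0, r1]
      nlinarith

end Geometry

/-! ### Translates by integers -/

section Translations

/-- The common critical point `τ_∞` of `E₆` in all translates `F₀ + m`. -/
lemma exists_criticalPoint_basicDomain :
    ∃ τ_inf : ℍ, τ_inf.re = 1 / 2 ∧ τ_inf.im ∈ Set.Ioo (1 / 2 : ℝ) (Real.sqrt 3 / 2) ∧
      τ_inf ∈ basicDomain ∧ ∀ γ : SL(2, ℤ), γ 1 0 = 0 → ∀ τ ∈ basicDomain,
        (derivE6 (γ • τ) = 0 ↔ τ = τ_inf) := by
  obtain ⟨ρ, hρ, hn, hcrit⟩ := exists_criticalForm_neg_eq_zero_iff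
  have h0 : 0 < ρ.re := hρ.1
  have h1 : ρ.re < 1 / 2 := hρ.2.1
  have hy : 0 < ρ.im := ρ.im_pos
  have hn2 : ρ.re ^ 2 + ρ.im ^ 2 = 1 := by rw [← norm_sq_coe, hn, one_pow]
  have hn3 : (1 - ρ.re) ^ 2 + ρ.im ^ 2 = 2 * (1 - ρ.re) := by linear_combination hn2
  have hρm : (ρ : ℂ) ∈ modularTriangle := ⟨h0.le, h1.le, hn.ge, hρ.2.2⟩
  have hρb : ρ ∈ basicDomain := (mem_basicDomain_iff ρ).mpr ⟨h0.le, by linarith, by linarith⟩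
  have hx : 0 < 2 * (1 - ρ.re) := by linarith
  refine ⟨triRot • ρ, ?_, ⟨?_, ?_⟩, triRot_smul_mem_basicDomain hρb, fun γ hc τ hτ => ?_⟩
  · rw [triRot_smul_re, hn3]
    rw [div_eq_iff hx.ne']; ring
  · rw [triRot_smul_im, hn3, lt_div_iff₀ hx]
    nlinarith
  · rw [triRot_smul_im, hn3, div_lt_iff₀ hx]
    have h3 : (Real.sqrt 3) ^ 2 = 3 := Real.sq_sqrt (by norm_num)
    have h3' : 0 ≤ Real.sqrt 3 := Real.sqrt_nonneg 3
    have h5 : ρ.im < Real.sqrt 3 * (1 - ρ.re) := by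
      refine lt_of_pow_lt_pow_left₀ 2 (mul_nonneg h3' (by linarith)) ?_
      rw [mul_pow, h3]
      nlinarith
    linarith
  have hdet := Matrix.SpecialLinearGroup.det_coe γ
  rw [Matrix.det_fin_two, hc] at hdet
  have hd : γ 1 1 ≠ 0 := by
    intro h; rw [h] at hdet; simp at hdet
  have hd2 : 0 < γ 1 1 * γ 1 1 := mul_self_pos.mpr hd
  constructor
  · intro hz
    obtain ⟨σ, hσ, rfl | rfl | rfl⟩ := exists_mem_upperPart hτ
    · rw [derivE6_smul_eq_zero_iff_criticalForm, hc] at hz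
      rcases criticalForm_eq_zero_cases hσ (.inr hd) hz with ⟨-, h, -⟩ | ⟨-, h, -⟩ <;>
        exact absurd rfl h
    · rw [derivE6_smul_triRot_iff, hc, zero_add] at hz
      rcases criticalForm_eq_zero_cases hσ (.inr hd) hz with ⟨hm, -⟩ | ⟨-, -, hle, -⟩
      · rw [(hcrit σ hm _ hd).mp hz]
      · nlinarith
    · rw [derivE6_smul_triRot_triRot_iff, hc, zero_add] at hz
      rcases criticalForm_eq_zero_cases hσ (.inl (neg_ne_zero.mpr hd)) hz with
        ⟨-, -, hle⟩ | ⟨hm, -, -, hz'⟩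
      · nlinarith
      · rw [neg_neg, sub_zero] at hz'
        have hσρ := (hcrit _ hm _ hd).mp hz'
        have : triRot • σ = ρ := by
          rw [← reflectHalf_reflectHalf σ, hσρ]
          apply UpperHalfPlane.ext_re_im
          · rw [triRot_smul_re, reflectHalf_re, reflectHalf_im, sub_sub_cancel, hn2, div_one]
          · rw [triRot_smul_im, reflectHalf_re, reflectHalf_im, sub_sub_cancel, hn2, div_one]
        rw [this]
  · rintro rfl
    rw [derivE6_smul_triRot_iff, hc, zero_add]
    exact (hcrit ρ hρm _ hd).mpr rfl

end Translations

theorem theorem1p1 :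
    ∃ τ_inf : ℍ, τ_inf.re = 1 / 2 ∧ τ_inf.im ∈ Set.Ioo (1 / 2 : ℝ) (Real.sqrt 3 / 2) ∧
      ∀ γ : SL(2, ℤ), γ ∈ CongruenceSubgroup.Gamma0 2 →
        (γ 1 0 = 0 →
          ∃ m : ℤ, (m : ℚ) = (γ 0 1 : ℚ) / (γ 1 1 : ℚ) ∧
            translatedDomain γ = (fun τ : ℍ => (m : ℝ) +ᵥ τ) '' basicDomain ∧
            criticalPointsIn (translatedDomain γ) = {(m : ℝ) +ᵥ τ_inf}) ∧
        (γ 1 0 ≠ 0 →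
          (criticalPointsIn (translatedDomain γ)).ncard = 2 ∧
            criticalPointsIn (translatedDomain γ) ⊆ interior (translatedDomain γ)) := by
  obtain ⟨τ_inf, hre, him, hmem, hcrit⟩ := exists_criticalPoint_basicDomain
  refine ⟨τ_inf, hre, him, fun γ hγ => ?_⟩
  have hdet := Matrix.SpecialLinearGroup.det_coe γ
  rw [Matrix.det_fin_two] at hdet
  refine ⟨fun hc => ?_, fun hc => ?_⟩
  · rw [hc, mul_zero, sub_zero] at hdet
    have had : γ 0 0 = γ 1 1 ∧ γ 1 1 * γ 1 1 = 1 := by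
      rcases Int.mul_eq_one_iff_eq_one_or_neg_one.mp hdet with ⟨h1, h2⟩ | ⟨h1, h2⟩ <;>
        rw [h1, h2] <;> norm_num
    have hd0 : γ 1 1 ≠ 0 := by intro h; rw [h] at hdet; simp at hdet
    have hsmul : ∀ τ : ℍ, γ • τ = ((γ 0 1 * γ 1 1 : ℤ) : ℝ) +ᵥ τ := by
      intro τ
      apply UpperHalfPlane.ext
      rw [UpperHalfPlane.coe_specialLinearGroup_apply, UpperHalfPlane.coe_vadd]
      have hd0' : (γ 1 1 : ℂ) ≠ 0 := by exact_mod_cast hd0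
      have h2 : (γ 1 1 : ℂ) * γ 1 1 = 1 := by exact_mod_cast had.2
      simp only [hc, had.1, algebraMap_int_eq, eq_intCast, Int.cast_zero, ofReal_zero, zero_mul,
        zero_add, ofReal_intCast]
      rw [div_eq_iff hd0']
      push_cast
      linear_combination (-(γ 0 1 : ℂ)) * h2
    refine ⟨γ 0 1 * γ 1 1, ?_, ?_, ?_⟩
    · have hd0' : (γ 1 1 : ℚ) ≠ 0 := by exact_mod_cast hd0
      have h2 : (γ 1 1 : ℚ) * γ 1 1 = 1 := by exact_mod_cast had.2
      rw [eq_div_iff hd0']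
      push_cast
      linear_combination (γ 0 1 : ℚ) * h2
    · rw [translatedDomain]
      simp only [hsmul]
    · rw [← hsmul]
      ext τ
      constructor
      · rintro ⟨⟨σ, hσ, rfl⟩, hz⟩
        rw [(hcrit γ hc σ hσ).mp hz]
        rfl
      · rintro rfl
        exact ⟨⟨τ_inf, hmem, rfl⟩, (hcrit γ hc τ_inf hmem).mpr rfl⟩
  · have h2 : (2 : ℤ) ∣ γ 1 0 := by
      rw [CongruenceSubgroup.Gamma0_mem] at hγ
      exact (ZMod.intCast_zmod_eq_zero_iff_dvd _ 2).mp hγ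
    -- An even `c` forces `d` to be odd, so that `-d/c` is neither `0` nor `1`.
    have hodd : ¬ (2 : ℤ) ∣ γ 1 1 := by
      intro h
      have : (2 : ℤ) ∣ 1 := by
        rw [← hdet]
        exact dvd_sub (h.mul_left _) (h2.mul_left _)
      norm_num at this
    refine criticalPoints_of_ne_zero hc ?_ ?_ <;> omega
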